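/- Let $\beta\in\mathbb R$, $\beta\neq 0$, let $n\ge 3$, and let $\Omega\subset\mathbb C\simeq\mathbb R^2$ be the interior of a convex polygon with vertices $z_1,\dots,z_n$ in counterclockwise order (indices modulo $n$; no three vertices are collinear). Its sides are $\Gamma_i=(z_i,z_{i+1})$. Write $|\Gamma_i|=|z_{i+1}-z_i|$, $\alpha_i=\arg(z_{i+1}-z_i)$, $\psi_i(\tau)=\tau z_{i+1}+(1-\tau)z_i$ for $\tau\in[0,1]$, and let $\mathbf n=-\mathrm i e^{\mathrm i\alpha_i}$ be the outward unit normal on $\Gamma_i$. Let $\mathcal E'[0,1]$ be the topological dual of the space $\mathcal E[0,1]$ of smooth functions $[0,1]\to\mathbb C$ (topology of the seminorms $\max_{[0,1]}|\varphi^{(k)}|$, $k\ge 0$). Let $\mathcal S(0,1)\subset\mathcal E[0,1]$ be the space of smooth $\varphi:(0,1)\to\mathbb C$ such that $\sup_{0<\tau<1}|\tau^{-m}(1-\tau)^{-m}\varphi^{(k)}(\tau)|<\infty$ for all $m,k\ge 0$ (extended by $0$ to the endpoints). Let $q_i,\partial_{\mathbf n}q_i\in\mathcal E'[0,1]$ be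 given for $i=1,\dots,n$; here $\partial_{\mathbf n}q_i$ is just the name of a second, independent datum. For $\lambda\in\mathbb C\setminus\{0\}$ put $$\rho_i(\lambda)=\mathrm i|\Gamma_i|\left[\langle\partial_{\mathbf n}q_i,e_{i,\lambda}\rangle+\Big(\lambda e^{\mathrm i\alpha_i}+\frac{\beta^2}{\lambda e^{\mathrm i\alpha_i}}\Big)\langle q_i,e_{i,\lambda}\rangle\right],\qquad e_{i,\lambda}(\tau)=e^{-\mathrm i\lambda\psi_i(\tau)+\mathrm i\beta^2\overline{\psi_i(\tau)}/\lambda}.$$ Suppose that the global relation $\sum_{i=1}^n\rho_i(\lambda)=0$ holds for all $\lambda\in\mathbb C\setminus\{0\}$. Define $$Q(z)=\frac1{4\pi\mathrm i}\sum_{i=1}^n\int_{\ell_i}e^{\mathrm i\lambda z-\mathrm i\beta^2\bar z/\lambda}\rho_i(\lambda)\,\frac{\mathrm d\lambda}{\lambda},$$ where $\ell_i$ is the ray $\arg\lambda=-\alpha_i$, oriented from $0$ to infinity. For a function $f$ on $\Omega$ and $u\in\mathcal E'[0,1]$, "$\lim_{z\to\Gamma_i}f=u$ in $\mathcal S'(\Gamma_i)$"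 means the following. Let $\Omega_\epsilon=\{z\in\Omega:\operatorname{dist}(z,\partial\Omega)\ge\epsilon\}$, let $\Gamma_i^\epsilon=\{z\in\Omega_\epsilon:\operatorname{dist}(z,\Gamma_i)=\epsilon\}$, which for small $\epsilon>0$ is the side of the polygon $\Omega_\epsilon$ parallel to $\Gamma_i$, and let $\psi_i^\epsilon:[0,1]\to\Gamma_i^\epsilon$ be its affine parametrisation in the direction of $\Gamma_i$. Then $\int_0^1 f(\psi_i^\epsilon(\tau))\varphi(\tau)\,\mathrm d\tau\to\langle u,\varphi\rangle$ as $\epsilon\downarrow 0$ for every $\varphi\in\mathcal S(0,1)$. Then: 1. The integrals that define $Q(z)$ converge absolutely for $z\in\Omega$, $Q\in C^\infty(\Omega)$, and $Q$ solves the modified Helmholtz equation $-\Delta Q+4\beta^2Q=0$ in $\Omega$. 2. For every $i$, $\lim_{z\to\Gamma_i}Q=q_i$ in $\mathcal S'(\Gamma_i)$. 3. For every $i$, $\lim_{z\to\Gamma_i}\partial Q/\partial\mathbf n=\partial_{\mathbf n}q_i$ in $\mathcal S'(\Gamma_i)$, and $\lim_{z\to\Gamma_i}(\partial Q/\partial\mathbf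 n+\gamma Q)=\partial_{\mathbf n}q_i+\gamma q_i$ in $\mathcal S'(\Gamma_i)$ for every $\gamma\in\mathbb C$. So $Q$ is a solution of the Dirichlet problem with data $q_i$, of the Neumann problem with data $\partial_{\mathbf n}q_i$, and of the Robin problem with data $\partial_{\mathbf n}q_i+\gamma q_i$. -/

import Mathlib

open Set Filter Topology
open scoped ContDiff

noncomputable section

namespace FokasPolygon

/-! ### Distributions on the closed interval -/

/-- Functions whose restriction to `[0,1]` is smooth up to the endpoints. The values outside `[0,1]`
are irrelevant: every continuous linear form below takes the same value on two elements that agree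
on `[0,1]`, because all the seminorms of their difference vanish. -/
def smoothIcc : Submodule ℂ (ℝ → ℂ) where
  carrier := {f | ContDiffOn ℝ ∞ f (Icc 0 1)}
  add_mem' hf hg := ContDiffOn.add hf hg
  zero_mem' := contDiffOn_const
  smul_mem' c _ hf := ContDiffOn.const_smul c hf

/-- The space `𝓔[0,1]` of smooth functions from `[0,1]` to `ℂ`. -/
def E01 : Type := smoothIcc

instance : AddCommGroup E01 := inferInstanceAs (AddCommGroup smoothIcc)

instance : Module ℂ E01 := inferInstanceAs (Module ℂ smoothIcc)

instance : CoeFun E01 (fun _ => ℝ → ℂ) := ⟨fun f => f.1⟩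

theorem E01.bddAbove (n : ℕ) (f : E01) :
    BddAbove (range fun τ : Icc (0 : ℝ) 1 => ‖iteratedDerivWithin n f (Icc 0 1) τ‖) := by
  have hc : ContinuousOn (iteratedDerivWithin n f (Icc 0 1)) (Icc (0 : ℝ) 1) :=
    ContDiffOn.continuousOn_iteratedDerivWithin (n := ∞) f.2
      (by exact_mod_cast le_top) (uniqueDiffOn_Icc zero_lt_one)
  have := (isCompact_Icc.image_of_continuousOn hc.norm).bddAbove
  rwa [image_eq_range] at this

/-- The seminorm `δ_n(f) = max_{τ ∈ [0,1]} |f⁽ⁿ⁾(τ)|` on `𝓔[0,1]` (one-sided derivatives at the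
endpoints). -/
def E01.seminorm (n : ℕ) : Seminorm ℂ E01 :=
  Seminorm.of (fun f => ⨆ τ : Icc (0 : ℝ) 1, ‖iteratedDerivWithin n f (Icc 0 1) τ‖)
    (fun f g => by
      refine ciSup_le fun τ => ?_
      have h1 := le_ciSup (E01.bddAbove n f) τ
      have h2 := le_ciSup (E01.bddAbove n g) τ
      have hf : ContDiffWithinAt ℝ n f.1 (Icc 0 1) τ :=
        (f.2 τ τ.2).of_le (by exact_mod_cast le_top)
      have hg : ContDiffWithinAt ℝ n g.1 (Icc 0 1) τ :=
        (g.2 τ τ.2).of_le (by exact_mod_cast le_top)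
      have h3 : iteratedDerivWithin n (f + g : E01) (Icc 0 1) (τ : ℝ) =
          iteratedDerivWithin n f (Icc 0 1) τ + iteratedDerivWithin n g (Icc 0 1) τ :=
        iteratedDerivWithin_add τ.2 (uniqueDiffOn_Icc zero_lt_one) hf hg
      rw [h3]
      exact (norm_add_le _ _).trans (add_le_add h1 h2))
    (fun c f => by
      rw [Real.mul_iSup_of_nonneg (norm_nonneg c)]
      refine iSup_congr fun τ => ?_
      have hf : ContDiffWithinAt ℝ n f.1 (Icc 0 1) τ :=
        (f.2 τ τ.2).of_le (by exact_mod_cast le_top)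
      have h3 : iteratedDerivWithin n (c • f : E01) (Icc 0 1) (τ : ℝ) =
          c • iteratedDerivWithin n f (Icc 0 1) τ :=
        iteratedDerivWithin_const_smul τ.2 (uniqueDiffOn_Icc zero_lt_one) c hf
      rw [h3, norm_smul])

/-- The topology of `𝓔[0,1]` generated by the seminorms `δ_n`. -/
instance : TopologicalSpace E01 :=
  (SeminormFamily.moduleFilterBasis (𝕜 := ℂ) (F := E01) E01.seminorm).topology

theorem E01.withSeminorms : WithSeminorms (𝕜 := ℂ) (E := E01) E01.seminorm := ⟨rfl⟩

/-- The space `𝓔'[0,1]` of continuous linear forms on `𝓔[0,1]`. -/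
abbrev E01Dual : Type := E01 →L[ℂ] ℂ

/-- The space `𝓢(0,1)`: smooth functions `φ` on `(0,1)` for which all the quantities
`sup_{0<τ<1} |τ⁻ᵐ (1-τ)⁻ᵐ φ⁽ⁿ⁾(τ)|` are finite. The values outside `(0,1)` are never used. -/
structure S01 where
  toFun : ℝ → ℂ
  smooth : ContDiffOn ℝ ∞ toFun (Ioo 0 1)
  flat : ∀ m n : ℕ, ∃ C : ℝ, ∀ τ ∈ Ioo (0 : ℝ) 1,
    (τ ^ m)⁻¹ * ((1 - τ) ^ m)⁻¹ * ‖iteratedDeriv n toFun τ‖ ≤ C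

instance : CoeFun S01 (fun _ => ℝ → ℂ) := ⟨S01.toFun⟩

theorem S01.hasDerivAt (φ : S01) (n : ℕ) (x : ℝ) :
    HasDerivAt ((Ioo (0 : ℝ) 1).indicator (iteratedDeriv n φ))
      ((Ioo (0 : ℝ) 1).indicator (iteratedDeriv (n + 1) φ) x) x := by
  by_cases hx : x ∈ Ioo (0 : ℝ) 1
  · have hnhds : Ioo (0 : ℝ) 1 ∈ 𝓝 x := isOpen_Ioo.mem_nhds hx
    rw [indicator_of_mem hx]
    have hw := φ.smooth.differentiableOn_iteratedDerivWithin (m := n)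
      (by exact_mod_cast ENat.natCast_lt_top n) isOpen_Ioo.uniqueDiffOn
    have hd : DifferentiableAt ℝ (iteratedDeriv n φ) x :=
      (hw.congr fun y hy => (iteratedDerivWithin_of_isOpen isOpen_Ioo hy).symm).differentiableAt
        hnhds
    have h1 := hd.hasDerivAt
    rw [← iteratedDeriv_succ] at h1
    refine h1.congr_of_eventuallyEq ?_
    filter_upwards [hnhds] with y hy using indicator_of_mem hy _
  · rw [indicator_of_notMem hx]
    obtain ⟨C, hC⟩ := φ.flat 2 n
    have key : ∀ y, ‖(Ioo (0 : ℝ) 1).indicator (iteratedDeriv n φ) y‖ ≤ |C| * ‖y - x‖ ^ 2 := by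
      intro y
      by_cases hy : y ∈ Ioo (0 : ℝ) 1
      · rw [indicator_of_mem hy]
        have hb := hC y hy
        obtain ⟨hy0, hy1⟩ := hy
        have hz : 0 < 1 - y := by linarith
        rw [← mul_inv, inv_mul_le_iff₀ (by positivity)] at hb
        have h1 : y ^ 2 * (1 - y) ^ 2 ≤ (y - x) ^ 2 := by
          rw [mem_Ioo, not_and_or, not_lt, not_lt] at hx
          rcases hx with hx | hx
          · have : y ^ 2 ≤ (y - x) ^ 2 := by nlinarith
            have h2 : (1 - y) ^ 2 ≤ 1 := by nlinarith
            nlinarith [sq_nonneg y]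
          · have : (1 - y) ^ 2 ≤ (y - x) ^ 2 := by nlinarith
            have h2 : y ^ 2 ≤ 1 := by nlinarith
            nlinarith [sq_nonneg (1 - y)]
        rw [Real.norm_eq_abs, sq_abs]
        calc _ ≤ y ^ 2 * (1 - y) ^ 2 * C := hb
          _ ≤ y ^ 2 * (1 - y) ^ 2 * |C| := by gcongr; exact le_abs_self C
          _ ≤ (y - x) ^ 2 * |C| := by gcongr
          _ = _ := mul_comm _ _
      · rw [indicator_of_notMem hy, norm_zero]
        positivity
    have hO : (Ioo (0 : ℝ) 1).indicator (iteratedDeriv n φ) =O[𝓝 x] fun y => ‖y - x‖ ^ 2 :=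
      Asymptotics.IsBigO.of_bound |C| (Eventually.of_forall fun y => by
        rw [norm_pow, norm_norm]; exact key y)
    simpa using (hO.hasFDerivAt one_lt_two).hasDerivAt

/-- The extension by zero of an element of `𝓢(0,1)` is smooth. -/
theorem S01.contDiff_extend (φ : S01) : ContDiff ℝ ∞ ((Ioo (0 : ℝ) 1).indicator φ) := by
  have h : ∀ n : ℕ, iteratedDeriv n ((Ioo (0 : ℝ) 1).indicator φ) =
      (Ioo (0 : ℝ) 1).indicator (iteratedDeriv n φ) := by
    intro n
    induction n with
    | zero => simp only [iteratedDeriv_zero]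
    | succ n ih =>
      rw [iteratedDeriv_succ, ih]
      exact funext fun x => (φ.hasDerivAt n x).deriv
  refine contDiff_of_differentiable_iteratedDeriv fun m _ => ?_
  rw [h m]
  exact fun x => (φ.hasDerivAt m x).differentiableAt

/-- The inclusion `𝓢(0,1) ⊂ 𝓔[0,1]`; it embeds `𝓔'[0,1]` data into `𝓢'(0,1)` by restriction. -/
def S01.toE01 (φ : S01) : E01 := ⟨(Ioo (0 : ℝ) 1).indicator φ, φ.contDiff_extend.contDiffOn⟩

/-! ### Convex polygons

The vertices are `z 0, …, z (n-1)`, the index `i + 1` is cyclic, and the side `Γ_i` joins `z i` to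
`z (i + 1)`. -/

variable {n : ℕ} [NeZero n]

/-- `z` lists, in counterclockwise order, the vertices of a (nondegenerate) convex polygon: every
vertex other than the endpoints of a side lies strictly to the left of that directed side. -/
def IsConvexPolygon (z : Fin n → ℂ) : Prop :=
  3 ≤ n ∧ ∀ i j : Fin n, j ≠ i → j ≠ i + 1 →
    0 < ((starRingEnd ℂ) (z (i + 1) - z i) * (z j - z i)).im

/-- The interior `Ω` of the polygon. -/
def interiorDomain (z : Fin n → ℂ) : Set ℂ := interior (convexHull ℝ (range z))

/-- The angle `α_i` of the side `Γ_i` with the positive real axis. -/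
def sideAngle (z : Fin n → ℂ) (i : Fin n) : ℝ := Complex.arg (z (i + 1) - z i)

/-- The length `|Γ_i|`. -/
def sideLength (z : Fin n → ℂ) (i : Fin n) : ℝ := ‖z (i + 1) - z i‖

/-- The outward unit normal `-i e^{iα_i}` of the side `Γ_i`. -/
def outwardNormal (z : Fin n → ℂ) (i : Fin n) : ℂ :=
  -Complex.I * Complex.exp (Complex.I * sideAngle z i)

/-- The affine parametrisation `τ ↦ τ b + (1 - τ) a` of the directed segment from `a` to `b`. -/
def affineParam (a b : ℂ) (τ : ℝ) : ℂ := (τ : ℂ) * b + (1 - τ : ℂ) * a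

/-- The parametrisation `ψ_i` of the side `Γ_i`. -/
def sideParam (z : Fin n → ℂ) (i : Fin n) (τ : ℝ) : ℂ := affineParam (z i) (z (i + 1)) τ

/-! ### Spectral functions and the integral representation -/

/-- `e^{-iλz + iβ²z̄/λ}`. -/
def kernel (β : ℝ) (l w : ℂ) : ℂ :=
  Complex.exp (-Complex.I * l * w + Complex.I * (β : ℂ) ^ 2 * (starRingEnd ℂ) w / l)

/-- The pullback `ψ_i^*(e^{-iλz + iβ²z̄/λ})`, as an element of `𝓔[0,1]`. -/
def kernelPullback (β : ℝ) (z : Fin n → ℂ) (i : Fin n) (l : ℂ) : E01 :=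
  ⟨fun τ => kernel β l (sideParam z i τ), by
    have h0 : ContDiff ℝ ∞ fun τ : ℝ => (τ : ℂ) := Complex.ofRealCLM.contDiff
    have h1 : ContDiff ℝ ∞ (sideParam z i) :=
      (h0.mul contDiff_const).add ((contDiff_const.sub h0).mul contDiff_const)
    have h2 : ContDiff ℝ ∞ fun τ : ℝ => (starRingEnd ℂ) (sideParam z i τ) :=
      Complex.conjCLE.contDiff.comp h1
    exact (((contDiff_const.mul h1).add
      ((contDiff_const.mul h2).div_const l)).cexp).contDiffOn⟩

/-- The spectral function `ρ_i(λ)` of the data `q` and `dq` (where `dq i` is the Neumann datum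
`∂_n q_i`). -/
def rho (β : ℝ) (z : Fin n → ℂ) (q dq : Fin n → E01Dual) (i : Fin n) (l : ℂ) : ℂ :=
  Complex.I * sideLength z i *
    (dq i (kernelPullback β z i l) +
      (l * Complex.exp (Complex.I * sideAngle z i) +
          (β : ℂ) ^ 2 / (l * Complex.exp (Complex.I * sideAngle z i))) *
        q i (kernelPullback β z i l))

/-- The global relation: `∑ ρ_i(λ) = 0` for all complex `λ ≠ 0`. -/
def GlobalRelation (β : ℝ) (z : Fin n → ℂ) (q dq : Fin n → E01Dual) : Prop :=
  ∀ l : ℂ, l ≠ 0 → ∑ i, rho β z q dq i l = 0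

/-- The integrand `e^{iλw - iβ²w̄/λ} ρ_i(λ) / λ`. -/
def integrand (β : ℝ) (z : Fin n → ℂ) (q dq : Fin n → E01Dual) (i : Fin n) (w l : ℂ) : ℂ :=
  Complex.exp (Complex.I * l * w - Complex.I * (β : ℂ) ^ 2 * (starRingEnd ℂ) w / l) *
    rho β z q dq i l / l

/-- The integrand pulled back by the parametrisation `r ↦ r e^{-iα_i}`, `r > 0`, of the ray `ℓ_i`
(oriented towards infinity). -/
def rayIntegrand (β : ℝ) (z : Fin n → ℂ) (q dq : Fin n → E01Dual) (i : Fin n) (w : ℂ) (r : ℝ) :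
    ℂ :=
  integrand β z q dq i w (r * Complex.exp (-Complex.I * sideAngle z i)) *
    Complex.exp (-Complex.I * sideAngle z i)

/-- The function `Q` defined by the integral representation over the rays `ℓ_i`. -/
def repQ (β : ℝ) (z : Fin n → ℂ) (q dq : Fin n → E01Dual) (w : ℂ) : ℂ :=
  1 / (4 * Real.pi * Complex.I) * ∑ i, ∫ r in Ioi (0 : ℝ), rayIntegrand β z q dq i w r

/-! ### Boundary limits -/

/-- `Ω_ε = {w ∈ Ω : dist(w, ∂Ω) ≥ ε}`. -/
def innerDomain (z : Fin n → ℂ) (ε : ℝ) : Set ℂ :=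
  {w ∈ interiorDomain z | ε ≤ Metric.infDist w (frontier (interiorDomain z))}

/-- The (closed) edge `Γ_i^ε` of `Ω_ε` that corresponds to `Γ_i`: the points of `Ω_ε` at distance
exactly `ε` from the side `Γ_i`. -/
def innerEdge (z : Fin n → ℂ) (i : Fin n) (ε : ℝ) : Set ℂ :=
  {w ∈ innerDomain z ε | Metric.infDist w (segment ℝ (z i) (z (i + 1))) = ε}

/-- The inner edge `Γ_i^ε` is the segment from `a` to `b`, with the same direction as `Γ_i`. This
determines `a` and `b`. -/
def IsInnerEdgeEndpoints (z : Fin n → ℂ) (i : Fin n) (ε : ℝ) (a b : ℂ) : Prop :=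
  segment ℝ a b = innerEdge z i ε ∧ ∃ c : ℝ, 0 < c ∧ b - a = (c : ℂ) * (z (i + 1) - z i)

/-- `lim_{w → Γ_i} f = u` in `𝓢'(Γ_i)`. For all small `ε > 0` the inner edge `Γ_i^ε` is the directed
segment from `a ε` to `b ε`, `ψ_i^ε` denotes its affine parametrisation, and
`∫_0^1 f(ψ_i^ε(τ)) φ(τ) dτ → ⟨u, φ⟩` as `ε ↓ 0` for every `φ ∈ 𝓢(0,1)`. -/
def HasBoundaryLimit (z : Fin n → ℂ) (i : Fin n) (f : ℂ → ℂ) (u : E01Dual) : Prop :=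
  ∃ a b : ℝ → ℂ,
    (∀ᶠ ε in 𝓝[>] (0 : ℝ), IsInnerEdgeEndpoints z i ε (a ε) (b ε)) ∧
    ∀ φ : S01, Tendsto (fun ε => ∫ τ in (0 : ℝ)..1, f (affineParam (a ε) (b ε) τ) * φ τ)
      (𝓝[>] (0 : ℝ)) (𝓝 (u φ.toE01))

end FokasPolygon

end

/-! Up to powers of `|λ| + 1/|λ|`, the `j`-th integrand at `w` is at most `exp(-(1 + β²/|λ|²) Im(λ(w
- y)))`, `y` being the worse endpoint of `Γ_j`. On a ray of direction `σ` it decays at both ends,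
like `exp(-c m (r + 1/r))`, once `Im(σ(w - z_j))` and `Im(σ(w - z_{j+1}))` are at least `m > 0`
(`IsSpectral.norm_rayFun_le`). For `σ = e^{-iα_j}` this says that `w` lies to the left of `Γ_j`.
Hence the integrals converge in `Ω` and may be differentiated under the sign, and each exponential
solves the equation.

For the boundary values at `Γ_i`, take `w` at height `ε` above `Γ_i` and its mirror image `w*`
across the line of `Γ_i`. All vertices lie on the other side of that line from `w*`, so all `n`
integrals over the ray opposite to `ℓ_i` converge at `w*`, and the global relation makes their sum
vanish. Subtracting this zero writes `Q(w)` as a sum of jumps (`rayJump`), treated one at a time.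

For `j ≠ i` the jump tends to zero: a ray may be turned inside the convex cone of decaying
directions without changing the integral (`IsSpectral.rayInt_eq_rayInt`), so on the open side both
integrals have the same limit. Near the corners they blow up only polynomially, which the flatness
of the test function absorbs (`IsConvexPolygon.tendsto_rayJump_offDiagonal`).

For `j = i` the two opposite rays become the real line under `y = L(r - β²/r)`. On the line of `ℓ_i`
the spectral function is `V + νU` with `ν = r + β²/r`, and `ν` changes sign with `r`. The `V` part
cancels and the `U` part doubles (`IsConvexPolygon.rayJump_diagonal`), leaving a damped Fourier
integral that returns the distribution behind `U` (`E01Dual.tendsto_integral_exp`).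

For `Q` itself `U` comes from `q_i`. The normal derivative multiplies the spectral function by `ν`,
and `ν²` is a function of `y`, so the two data exchange roles and `∂_n q_i` survives. The Robin
limit is the combination of both. -/

noncomputable section

namespace FokasPolygon

/-! ### Structure of the elements of `𝓔'[0,1]` -/

/-- The `k`-th derivative of an element of `𝓔[0,1]`, as a continuous function. -/
def E01.jet (k : ℕ) : E01 →ₗ[ℂ] C(Icc (0 : ℝ) 1, ℂ) where
  toFun f := ⟨fun t => iteratedDerivWithin k f (Icc 0 1) t, by
    have hc : ContinuousOn (iteratedDerivWithin k f (Icc 0 1)) (Icc (0 : ℝ) 1) :=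
      ContDiffOn.continuousOn_iteratedDerivWithin (n := ∞) f.2
        (by exact_mod_cast le_top) (uniqueDiffOn_Icc zero_lt_one)
    exact hc.domRestrict⟩
  map_add' f g := by
    ext t
    exact iteratedDerivWithin_add t.2 (uniqueDiffOn_Icc zero_lt_one)
      ((f.2 t t.2).of_le (by exact_mod_cast le_top)) ((g.2 t t.2).of_le (by exact_mod_cast le_top))
  map_smul' c f := by
    ext t
    exact iteratedDerivWithin_const_smul t.2 (uniqueDiffOn_Icc zero_lt_one) c
      ((f.2 t t.2).of_le (by exact_mod_cast le_top))

theorem E01.seminorm_le_norm_jet (k : ℕ) (f : E01) : E01.seminorm k f ≤ ‖E01.jet k f‖ :=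
  ciSup_le fun t => (E01.jet k f).norm_coe_le_norm t

/-- Every element of `𝓔'[0,1]` is a finite sum of measures applied to derivatives. -/
theorem E01Dual.exists_eq_sum_jet (u : E01Dual) :
    ∃ (s : Finset ℕ) (Λ : s → (C(Icc (0 : ℝ) 1, ℂ) →L[ℂ] ℂ)),
      ∀ f : E01, u f = ∑ k : s, Λ k (E01.jet k f) := by
  have hq : Continuous (u.toLinearMap.toSeminorm) := by
    exact continuous_norm.comp u.continuous
  obtain ⟨s, C, -, hC⟩ := Seminorm.bound_of_continuous E01.withSeminorms _ hq
  -- Continuity controls `u` by finitely many seminorms, hence by the norm of the tuple of jets in a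
  -- finite product of copies of `C[0,1]`.
  have hb : ∀ f : E01, ‖u f‖ ≤ C * ‖fun k : s => E01.jet k f‖ := by
    intro f
    refine (hC f).trans ?_
    change (C : ℝ) * (s.sup E01.seminorm) f ≤ _
    gcongr
    refine Seminorm.finset_sup_apply_le (norm_nonneg _) fun k hk => ?_
    exact (E01.seminorm_le_norm_jet k f).trans
      (norm_le_pi_norm (fun k : s => E01.jet k f) ⟨k, hk⟩)
  let T : E01 →ₗ[ℂ] (s → C(Icc (0 : ℝ) 1, ℂ)) := LinearMap.pi fun k => E01.jet k
  -- By the bound, `u` depends on `T f` only. It descends to the range of `T` and extends by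
  -- Hahn–Banach; the coordinates of the extension are the `Λ k`.
  have hker : LinearMap.ker T ≤ LinearMap.ker u.toLinearMap := fun f hf => by
    have h1 : (fun k : s => E01.jet k f) = 0 := hf
    have h2 := hb f
    rw [h1, norm_zero, mul_zero] at h2
    exact norm_le_zero_iff.mp h2
  let g₀ : LinearMap.range T →ₗ[ℂ] ℂ :=
    ((LinearMap.ker T).liftQ u.toLinearMap hker).comp T.quotKerEquivRange.symm.toLinearMap
  have hg₀ : ∀ f, g₀ ⟨T f, LinearMap.mem_range_self T f⟩ = u f := fun f => by
    have h1 : T.quotKerEquivRange.symm ⟨T f, LinearMap.mem_range_self T f⟩ =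
        (LinearMap.ker T).mkQ f := T.quotKerEquivRange_symm_apply_image f _
    change (LinearMap.ker T).liftQ u.toLinearMap hker (T.quotKerEquivRange.symm _) = _
    rw [h1]
    rfl
  let g : StrongDual ℂ (LinearMap.range T) :=
    LinearMap.mkContinuous (E := LinearMap.range T) (F := ℂ) (σ := RingHom.id ℂ) g₀ C fun y => by
    obtain ⟨_, f, rfl⟩ := y
    rw [hg₀ f]
    exact hb f
  obtain ⟨G, hG, -⟩ := exists_extension_norm_eq (LinearMap.range T) g
  have hu : ∀ f, u f = G (T f) := fun f =>
    (hg₀ f).symm.trans (hG ⟨T f, LinearMap.mem_range_self T f⟩).symm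
  classical
  refine ⟨s, fun k => G.comp (ContinuousLinearMap.single ℂ (fun _ : s => C(Icc (0 : ℝ) 1, ℂ)) k),
    fun f => ?_⟩
  rw [hu f]
  conv_lhs => rw [← LinearMap.sum_single_apply (φ := fun _ : s => C(Icc (0 : ℝ) 1, ℂ)) (T f)]
  rw [map_sum]
  rfl

/-- The function `τ ↦ e^{Aτ}` of `𝓔[0,1]`. -/
def E01.exp (A : ℂ) : E01 := ⟨fun τ => Complex.exp (A * τ), by
  have h0 : ContDiff ℝ ∞ fun τ : ℝ => (τ : ℂ) := Complex.ofRealCLM.contDiff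
  exact (contDiff_const.mul h0).cexp.contDiffOn⟩

/-- The inclusion of `[0,1]` in `ℂ`. -/
def unitIncl : C(Icc (0 : ℝ) 1, ℂ) := ⟨fun t => ((t : ℝ) : ℂ), by fun_prop⟩

/-- Realising `τ ↦ e^{Aτ}` as an exponential in the Banach algebra `C[0,1]` gives holomorphy in `A`
with values in `C[0,1]`, which a bounded functional then preserves. -/
theorem exp_smul_unitIncl_apply (A : ℂ) (t : Icc (0 : ℝ) 1) :
    NormedSpace.exp (A • unitIncl) t = Complex.exp (A * t) := by
  have h := NormedSpace.map_exp (ContinuousMap.evalAlgHom ℂ ℂ t)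
    (continuous_eval_const t) (A • unitIncl)
  rw [← Complex.exp_eq_exp_ℂ] at h
  exact h

theorem iteratedDerivWithin_cexp_mul (A : ℂ) (k : ℕ) {t : ℝ} (ht : t ∈ Icc (0 : ℝ) 1) :
    iteratedDerivWithin k (fun τ : ℝ => Complex.exp (A * τ)) (Icc 0 1) t =
      A ^ k * Complex.exp (A * t) := by
  induction k generalizing t with
  | zero => simp
  | succ k ih =>
    rw [iteratedDerivWithin_succ]
    have h1 : HasDerivAt (fun τ : ℝ => A ^ k * Complex.exp (A * τ))
        (A ^ (k + 1) * Complex.exp (A * t)) t := by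
      have := ((((hasDerivAt_id (t : ℂ)).const_mul A).cexp).const_mul (A ^ k)).comp_ofReal
      refine this.congr_deriv ?_
      simp only [id]; ring
    rw [derivWithin_congr (fun y hy => ih hy) (ih ht)]
    exact h1.hasDerivWithinAt.derivWithin (uniqueDiffOn_Icc zero_lt_one t ht)

theorem E01.jet_exp (k : ℕ) (A : ℂ) :
    E01.jet k (E01.exp A) = A ^ k • NormedSpace.exp (A • unitIncl) := by
  ext t
  rw [ContinuousMap.smul_apply, exp_smul_unitIncl_apply]
  exact iteratedDerivWithin_cexp_mul A k t.2

theorem norm_exp_smul_unitIncl_le (A : ℂ) :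
    ‖(NormedSpace.exp (A • unitIncl) : C(Icc (0 : ℝ) 1, ℂ))‖ ≤ Real.exp (max A.re 0) := by
  refine (ContinuousMap.norm_le _ (Real.exp_pos _).le).2 fun t => ?_
  rw [exp_smul_unitIncl_apply, Complex.norm_exp, Real.exp_le_exp, Complex.re_mul_ofReal]
  rcases le_total A.re 0 with h | h
  · exact (mul_nonpos_of_nonpos_of_nonneg h t.2.1).trans (le_max_right _ _)
  · exact (mul_le_of_le_one_right h t.2.2).trans (le_max_left _ _)

theorem E01Dual.differentiable_exp (u : E01Dual) : Differentiable ℂ fun A => u (E01.exp A) := by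
  obtain ⟨s, Λ, h⟩ := u.exists_eq_sum_jet
  simp_rw [h, E01.jet_exp, map_smul]
  refine Differentiable.fun_sum fun k _ => ?_
  exact (differentiable_pow (k : ℕ)).fun_smul
    ((Λ k).differentiable.comp (differentiable_exp_smul_const ℂ unitIncl))

/-- The easy half of Paley–Wiener: derivatives of `e^{Aτ}` produce powers of `A`, and `0 ≤ τ ≤ 1`
produces the exponential factor. -/
theorem E01Dual.exists_norm_exp_le (u : E01Dual) :
    ∃ (C : ℝ) (N : ℕ), 0 ≤ C ∧
      ∀ A, ‖u (E01.exp A)‖ ≤ C * (1 + ‖A‖) ^ N * Real.exp (max A.re 0) := by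
  obtain ⟨s, Λ, h⟩ := u.exists_eq_sum_jet
  refine ⟨∑ k : s, ‖Λ k‖, s.sup id, by positivity, fun A => ?_⟩
  rw [h, Finset.sum_mul, Finset.sum_mul]
  refine norm_sum_le_of_le _ fun k _ => ?_
  rw [E01.jet_exp, map_smul, norm_smul, norm_pow, mul_assoc, mul_left_comm]
  have h1 : ‖A‖ ^ (k : ℕ) ≤ (1 + ‖A‖) ^ s.sup id := by
    have : (k : ℕ) ≤ s.sup id := Finset.le_sup (f := id) k.2
    calc ‖A‖ ^ (k : ℕ) ≤ (1 + ‖A‖) ^ (k : ℕ) := by gcongr; linarith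
      _ ≤ _ := pow_le_pow_right₀ (by linarith [norm_nonneg A]) this
  refine mul_le_mul h1 (((Λ k).le_opNorm _).trans ?_) (norm_nonneg _) (by positivity)
  gcongr
  exact norm_exp_smul_unitIncl_le A

/-- The restriction to `[0,1]` of a smooth function on `ℝ`. -/
def E01.ofContDiff (f : ℝ → ℂ) (hf : ContDiff ℝ ∞ f) : E01 := ⟨f, hf.contDiffOn⟩

open MeasureTheory FourierTransform in
/-- An element of `𝓔'[0,1]` commutes with the Fourier inversion integral. -/
theorem E01Dual.integral_fourier_mul_exp (u : E01Dual) {f : ℝ → ℂ} (hf : ContDiff ℝ ∞ f)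
    (hc : HasCompactSupport f) :
    ∫ x : ℝ, 𝓕 f x * u (E01.exp (2 * Real.pi * Complex.I * x)) = u (E01.ofContDiff f hf) := by
  obtain ⟨s, Λ, h⟩ := u.exists_eq_sum_jet
  have hs : ∀ k : ℕ, ContDiff ℝ ∞ (iteratedDeriv k f) := fun k => by
    rw [iteratedDeriv_eq_iterate]
    exact hf.iterate_deriv k
  have hsupp : ∀ k : ℕ, HasCompactSupport (iteratedDeriv k f) := fun k => by
    induction k with
    | zero => simpa using hc
    | succ k ih => rw [iteratedDeriv_succ]; exact ih.deriv
  let ψ : ℕ → SchwartzMap ℝ ℂ := fun k => (hsupp k).toSchwartzMap (hs k)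
  have hF : ∀ k : ℕ, ∀ x : ℝ, 𝓕 (ψ k) x = (2 * Real.pi * Complex.I * x) ^ k * 𝓕 f x := by
    intro k x
    rw [SchwartzMap.fourier_coe]
    exact congrFun (Real.fourier_iteratedDeriv (N := ⊤) (n := k) (by exact_mod_cast hf)
      (fun n _ => (hs n).continuous.integrable_of_hasCompactSupport (hsupp n)) le_top) x
  let E : ℝ → C(Icc (0 : ℝ) 1, ℂ) := fun x =>
    NormedSpace.exp ((2 * Real.pi * Complex.I * x : ℂ) • unitIncl)
  have hEc : Continuous E := (differentiable_exp_smul_const ℂ unitIncl).continuous.comp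
    (by fun_prop)
  have hEn : ∀ x, ‖E x‖ ≤ 1 := fun x => by
    refine (norm_exp_smul_unitIncl_le _).trans_eq ?_
    simp
  have hint : ∀ k : ℕ, Integrable fun x => 𝓕 (ψ k) x • E x := fun k => by
    refine ((𝓕 (ψ k)).integrable (μ := volume)).mono
      ((𝓕 (ψ k)).continuous.smul hEc).aestronglyMeasurable (Eventually.of_forall fun x => ?_)
    rw [norm_smul]
    exact mul_le_of_le_one_right (norm_nonneg _) (hEn x)
  -- Fourier inversion holds in `C[0,1]` for every derivative of `f` separately, because `𝓕 (ψ k)`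
  -- is integrable and the exponentials have norm at most one. So only the bounded functionals `Λ k`
  -- have to pass through an integral, never `u` itself.
  have hval : ∀ k : ℕ, ∫ x, 𝓕 (ψ k) x • E x = E01.jet k (E01.ofContDiff f hf) := fun k => by
    ext t
    rw [ContinuousMap.integral_apply (hint k)]
    have h1 : 𝓕⁻ (𝓕 (ψ k)) t = ψ k t := by rw [fourierInv_fourier_eq]
    have h2 : E01.jet k (E01.ofContDiff f hf) t = ψ k t :=
      iteratedDerivWithin_eq_iteratedDeriv (uniqueDiffOn_Icc zero_lt_one)
        (hf.contDiffAt.of_le (by exact_mod_cast le_top)) t.2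
    rw [h2, ← h1, SchwartzMap.fourierInv_coe, Real.fourierInv_eq']
    refine integral_congr_ae (Eventually.of_forall fun x => ?_)
    simp only [ContinuousMap.smul_apply, smul_eq_mul, E]
    rw [exp_smul_unitIncl_apply, mul_comm]
    congr 2
    simp
    ring
  rw [h, ← integral_congr_ae (Eventually.of_forall fun x => ?_ :
    (fun x => ∑ k : s, Λ k (𝓕 (ψ k) x • E x)) =ᵐ[volume] _), integral_finsetSum]
  · refine Finset.sum_congr rfl fun k _ => ?_
    rw [(Λ k).integral_comp_comm (hint k), hval]
  · exact fun k _ => (Λ k).integrable_comp (hint k)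
  · simp only
    rw [h, Finset.mul_sum]
    refine Finset.sum_congr rfl fun k _ => ?_
    rw [E01.jet_exp, map_smul, map_smul, hF, smul_eq_mul, smul_eq_mul]
    ring

end FokasPolygon

end

noncomputable section

namespace FokasPolygon

open MeasureTheory

/-! ### Integrals over rays -/

/-- Holomorphic functions on `λ ≠ 0` with the growth of the spectral functions of distributions on
the segment from `a` to `b`. -/
def IsSpectral (β : ℝ) (a b : ℂ) (F : ℂ → ℂ) : Prop :=
  DifferentiableOn ℂ F {0}ᶜ ∧ ∃ (C : ℝ) (M : ℕ), 0 ≤ C ∧ ∀ l, l ≠ 0 →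
    ‖F l‖ ≤ C * (‖l‖ + ‖l‖⁻¹) ^ M *
      Real.exp ((1 + β ^ 2 / ‖l‖ ^ 2) * max (l * a).im (l * b).im)

/-- The integrand `e^{iλw - iβ²w̄/λ} F(λ) / λ`. -/
def rayKernel (β : ℝ) (F : ℂ → ℂ) (w l : ℂ) : ℂ :=
  Complex.exp (Complex.I * l * w - Complex.I * (β : ℂ) ^ 2 * (starRingEnd ℂ) w / l) * F l / l

/-- The integrand `rayKernel` pulled back to the ray spanned by `σ`. -/
def rayFun (β : ℝ) (F : ℂ → ℂ) (σ w : ℂ) (r : ℝ) : ℂ := rayKernel β F w (r * σ) * σ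

/-- The integral of `rayKernel` over the ray spanned by `σ`. -/
def rayInt (β : ℝ) (F : ℂ → ℂ) (σ w : ℂ) : ℂ := ∫ r in Ioi (0 : ℝ), rayFun β F σ w r

/-- The points `w` for which the integral over the ray spanned by `σ` decays, for functions
that are spectral for the segment from `a` to `b`. -/
def decayDomain (a b σ : ℂ) : Set ℂ := {w | 0 < (σ * (w - a)).im ∧ 0 < (σ * (w - b)).im}

theorem isOpen_decayDomain (a b σ : ℂ) : IsOpen (decayDomain a b σ) :=
  (isOpen_lt continuous_const (g := fun w : ℂ => (σ * (w - a)).im) (by fun_prop)).inter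
    (isOpen_lt continuous_const (g := fun w : ℂ => (σ * (w - b)).im) (by fun_prop))

theorem ne_zero_of_mem_decayDomain {a b σ w : ℂ} (h : w ∈ decayDomain a b σ) : σ ≠ 0 := by
  rintro rfl
  simpa using h.1

/-- `w̄/λ` equals the conjugate of `λw` divided by `|λ|²`, so both terms of the phase have real part
a multiple of `Im(λw)`, with the same sign. -/
theorem norm_exp_phase (β : ℝ) (w : ℂ) {l : ℂ} (hl : l ≠ 0) :
    ‖Complex.exp (Complex.I * l * w - Complex.I * (β : ℂ) ^ 2 * (starRingEnd ℂ) w / l)‖ =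
      Real.exp (-((1 + β ^ 2 / ‖l‖ ^ 2) * (l * w).im)) := by
  rw [Complex.norm_exp]
  congr 1
  have h1 : Complex.I * (β : ℂ) ^ 2 * (starRingEnd ℂ) w / l =
      ((β ^ 2 / ‖l‖ ^ 2 : ℝ) : ℂ) * (Complex.I * (starRingEnd ℂ) (l * w)) := by
    have h2 : (starRingEnd ℂ) l ≠ 0 := by simpa using hl
    push_cast
    rw [← Complex.conj_mul', map_mul]
    field_simp
  rw [h1, Complex.sub_re, Complex.re_ofReal_mul, mul_assoc, Complex.I_mul_re, Complex.I_mul_re,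
    Complex.conj_im]
  ring

theorem norm_rayFun (β : ℝ) (F : ℂ → ℂ) {σ : ℂ} (hσ : σ ≠ 0) (w : ℂ) {r : ℝ} (hr : 0 < r) :
    ‖rayFun β F σ w r‖ = Real.exp (-((1 + β ^ 2 / ‖(r * σ : ℂ)‖ ^ 2) * (r * σ * w).im)) *
      ‖F (r * σ)‖ * r⁻¹ := by
  have hl : (r * σ : ℂ) ≠ 0 := mul_ne_zero (by exact_mod_cast hr.ne') hσ
  have h0 : ‖σ‖ ≠ 0 := norm_ne_zero_iff.2 hσ
  rw [rayFun, rayKernel, norm_mul, norm_div, norm_mul, norm_exp_phase β w hl]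
  rw [show ‖(r * σ : ℂ)‖ = r * ‖σ‖ by rw [norm_mul, Complex.norm_of_nonneg hr.le]]
  field_simp

/-- With `λ = rσ` the exponents combine to at most `-(1 + β²/|λ|²) r m`. The `1` gives decay at
infinity and `β²/|λ|²` decay at zero, where `β ≠ 0` is needed. The constants are uniform for `σ` in
an annulus, which differentiation in `σ` will require. -/
theorem IsSpectral.norm_rayFun_le {β : ℝ} (hβ : β ≠ 0) {a b : ℂ} {F : ℂ → ℂ}
    (hF : IsSpectral β a b F) {K : ℝ} (hK : 0 < K) :
    ∃ (C c : ℝ) (M : ℕ), 0 ≤ C ∧ 0 < c ∧ ∀ σ : ℂ, K⁻¹ ≤ ‖σ‖ → ‖σ‖ ≤ K → ∀ (w : ℂ) (m : ℝ), 0 ≤ m →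
      m ≤ (σ * (w - a)).im → m ≤ (σ * (w - b)).im → ∀ r : ℝ, 0 < r →
      ‖rayFun β F σ w r‖ ≤ C * ((r + r⁻¹) ^ M * Real.exp (-(c * m * (r + r⁻¹)))) := by
  obtain ⟨-, C, M, hC, hb⟩ := hF
  -- `|σ| ≤ K` yields the `β²/K²` in front of `1/r`; the extra power of `r + 1/r` absorbs the factor
  -- `1/r` of `dλ/λ`.
  refine ⟨C * K ^ M, min 1 (β ^ 2 / K ^ 2), M + 1, by positivity, by positivity, ?_⟩
  intro σ h1 h2 w m hm ha hb' r hr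
  set c := min 1 (β ^ 2 / K ^ 2) with hc
  have hσ0 : 0 < ‖σ‖ := (inv_pos.2 hK).trans_le h1
  have hσ : σ ≠ 0 := norm_pos_iff.1 hσ0
  have hl : (r * σ : ℂ) ≠ 0 := mul_ne_zero (by exact_mod_cast hr.ne') hσ
  have hln : ‖(r * σ : ℂ)‖ = r * ‖σ‖ := by rw [norm_mul, Complex.norm_of_nonneg hr.le]
  rw [norm_rayFun β F hσ w hr]
  have hmax : max (r * σ * a).im (r * σ * b).im ≤ (r * σ * w).im - r * m := by
    have e : ∀ x : ℂ, (r * σ * x).im = r * (σ * x).im := fun x => by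
      rw [mul_assoc, Complex.im_ofReal_mul]
    rw [mul_sub, Complex.sub_im] at ha hb'
    rw [e, e, e, max_le_iff]
    constructor <;> nlinarith
  have hexp : Real.exp (-((1 + β ^ 2 / ‖(r * σ : ℂ)‖ ^ 2) * (r * σ * w).im)) *
      Real.exp ((1 + β ^ 2 / ‖(r * σ : ℂ)‖ ^ 2) * max (r * σ * a).im (r * σ * b).im) ≤
      Real.exp (-(c * m * (r + r⁻¹))) := by
    rw [← Real.exp_add, Real.exp_le_exp]
    have hk : 0 ≤ 1 + β ^ 2 / ‖(r * σ : ℂ)‖ ^ 2 := by positivity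
    have h3 := mul_le_mul_of_nonneg_left hmax hk
    have h4 : c * (r + r⁻¹) ≤ (1 + β ^ 2 / ‖(r * σ : ℂ)‖ ^ 2) * r := by
      rw [hln, mul_add, add_mul]
      refine add_le_add (mul_le_mul_of_nonneg_right (min_le_left _ _) hr.le) ?_
      calc c * r⁻¹ ≤ β ^ 2 / K ^ 2 * r⁻¹ := by gcongr; exact min_le_right _ _
        _ ≤ β ^ 2 / ‖σ‖ ^ 2 * r⁻¹ := by gcongr
        _ = _ := by field_simp
    nlinarith [mul_le_mul_of_nonneg_right h4 hm]
  have hsum : ‖(r * σ : ℂ)‖ + ‖(r * σ : ℂ)‖⁻¹ ≤ K * (r + r⁻¹) := by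
    rw [hln, mul_inv, mul_add, mul_comm r, mul_comm r⁻¹]
    gcongr
    exact inv_le_of_inv_le₀ hK h1
  calc _ ≤ Real.exp (-((1 + β ^ 2 / ‖(r * σ : ℂ)‖ ^ 2) * (r * σ * w).im)) *
        (C * (‖(r * σ : ℂ)‖ + ‖(r * σ : ℂ)‖⁻¹) ^ M *
        Real.exp ((1 + β ^ 2 / ‖(r * σ : ℂ)‖ ^ 2) * max (r * σ * a).im (r * σ * b).im)) *
        (r + r⁻¹) := by
          gcongr
          · exact hb _ hl
          · linarith
    _ = C * (‖(r * σ : ℂ)‖ + ‖(r * σ : ℂ)‖⁻¹) ^ M * (r + r⁻¹) *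
        (Real.exp (-((1 + β ^ 2 / ‖(r * σ : ℂ)‖ ^ 2) * (r * σ * w).im)) *
        Real.exp ((1 + β ^ 2 / ‖(r * σ : ℂ)‖ ^ 2) * max (r * σ * a).im (r * σ * b).im)) := by ring
    _ ≤ C * (K * (r + r⁻¹)) ^ M * (r + r⁻¹) * Real.exp (-(c * m * (r + r⁻¹))) := by gcongr
    _ = _ := by rw [mul_pow]; ring

/-- The bound `e^x ≥ x^k / k!` with `k = M + 2`: two powers beyond `M` leave the integrable `1/(1 +
r²)`. The price is a power of `1/δ`, so ray integrals blow up only polynomially at the edge of the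
decay domain. -/
theorem add_inv_pow_mul_exp_le (M : ℕ) {δ r : ℝ} (hδ : 0 < δ) (hr : 0 < r) :
    (r + r⁻¹) ^ M * Real.exp (-(δ * (r + r⁻¹))) ≤
      (M + 2).factorial / δ ^ (M + 2) * (1 + r ^ 2)⁻¹ := by
  have hx : 0 < r + r⁻¹ := by positivity
  set x := r + r⁻¹ with hxdef
  have h1 := Real.pow_div_factorial_le_exp (δ * x) (by positivity) (M + 2)
  have h2 : (x ^ 2)⁻¹ ≤ (1 + r ^ 2)⁻¹ := by
    apply inv_anti₀ (by positivity)
    have : r * r⁻¹ = 1 := mul_inv_cancel₀ hr.ne'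
    nlinarith [sq_nonneg r⁻¹]
  calc x ^ M * Real.exp (-(δ * x)) = x ^ M * (Real.exp (δ * x))⁻¹ := by rw [Real.exp_neg]
    _ ≤ x ^ M * ((δ * x) ^ (M + 2) / (M + 2).factorial)⁻¹ := by gcongr
    _ = (M + 2).factorial / δ ^ (M + 2) * (x ^ 2)⁻¹ := by rw [mul_pow]; field_simp; ring
    _ ≤ _ := by gcongr

theorem integrableOn_add_inv_pow_mul_exp (M : ℕ) {δ : ℝ} (hδ : 0 < δ) :
    IntegrableOn (fun r : ℝ => (r + r⁻¹) ^ M * Real.exp (-(δ * (r + r⁻¹)))) (Ioi 0) := by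
  refine Integrable.mono' (g := fun r : ℝ => (M + 2).factorial / δ ^ (M + 2) * (1 + r ^ 2)⁻¹)
    ((integrable_inv_one_add_sq.const_mul _).integrableOn) ?_ ?_
  · exact (by fun_prop : Measurable _).aestronglyMeasurable
  · filter_upwards [ae_restrict_mem measurableSet_Ioi] with r hr
    have hr : 0 < r := hr
    rw [Real.norm_of_nonneg (by positivity)]
    exact add_inv_pow_mul_exp_le M hδ hr

theorem IsSpectral.continuousOn_rayFun {β : ℝ} {a b : ℂ} {F : ℂ → ℂ}
    (hF : IsSpectral β a b F) {σ : ℂ} (hσ : σ ≠ 0) (w : ℂ) :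
    ContinuousOn (rayFun β F σ w) (Ioi 0) := by
  have h0 : ∀ r ∈ Ioi (0 : ℝ), (r * σ : ℂ) ≠ 0 := fun r hr =>
    mul_ne_zero (by exact_mod_cast (ne_of_gt hr)) hσ
  have h1 : ContinuousOn (fun r : ℝ => F (r * σ)) (Ioi 0) :=
    hF.1.continuousOn.comp (by fun_prop) h0
  unfold rayFun rayKernel
  refine ContinuousOn.mul (ContinuousOn.div (ContinuousOn.mul ?_ h1) (by fun_prop) h0) (by fun_prop)
  refine (ContinuousOn.sub (by fun_prop) (ContinuousOn.div (by fun_prop) (by fun_prop) h0)).cexp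

theorem IsSpectral.aestronglyMeasurable_rayFun {β : ℝ} {a b : ℂ} {F : ℂ → ℂ}
    (hF : IsSpectral β a b F) {σ : ℂ} (hσ : σ ≠ 0) (w : ℂ) :
    AEStronglyMeasurable (rayFun β F σ w) (volume.restrict (Ioi 0)) :=
  (hF.continuousOn_rayFun hσ w).aestronglyMeasurable measurableSet_Ioi

/-- On a fixed ray, the integrand is dominated locally uniformly on the decay domain. -/
theorem IsSpectral.norm_rayFun_le' {β : ℝ} (hβ : β ≠ 0) {a b : ℂ} {F : ℂ → ℂ}
    (hF : IsSpectral β a b F) {σ : ℂ} (hσ : σ ≠ 0) :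
    ∃ (C c : ℝ) (M : ℕ), 0 ≤ C ∧ 0 < c ∧ ∀ (w : ℂ) (m : ℝ), 0 ≤ m →
      m ≤ (σ * (w - a)).im → m ≤ (σ * (w - b)).im → ∀ r : ℝ, 0 < r →
      ‖rayFun β F σ w r‖ ≤ C * ((r + r⁻¹) ^ M * Real.exp (-(c * m * (r + r⁻¹)))) := by
  have h0 : 0 < ‖σ‖ := norm_pos_iff.2 hσ
  obtain ⟨C, c, M, hC, hc, h⟩ := hF.norm_rayFun_le hβ (K := ‖σ‖ + ‖σ‖⁻¹) (by positivity)
  refine ⟨C, c, M, hC, hc, h σ ?_ ?_⟩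
  · rw [inv_le_comm₀ (by positivity) h0]
    linarith
  · have := inv_pos.2 h0
    linarith

theorem IsSpectral.integrableOn_rayFun {β : ℝ} (hβ : β ≠ 0) {a b : ℂ} {F : ℂ → ℂ}
    (hF : IsSpectral β a b F) {σ w : ℂ} (hw : w ∈ decayDomain a b σ) :
    IntegrableOn (rayFun β F σ w) (Ioi 0) := by
  have hσ := ne_zero_of_mem_decayDomain hw
  obtain ⟨C, c, M, hC, hc, h⟩ := hF.norm_rayFun_le' hβ hσ
  have hm : 0 < min (σ * (w - a)).im (σ * (w - b)).im := lt_min hw.1 hw.2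
  refine Integrable.mono' ((integrableOn_add_inv_pow_mul_exp M (mul_pos hc hm)).const_mul C)
    (hF.aestronglyMeasurable_rayFun hσ w) ?_
  filter_upwards [ae_restrict_mem measurableSet_Ioi] with r hr
  exact h w _ hm.le (min_le_left _ _) (min_le_right _ _) r hr

/-- Ray integrals grow at most polynomially at the boundary of the decay domain. -/
theorem IsSpectral.exists_norm_rayInt_le {β : ℝ} (hβ : β ≠ 0) {a b : ℂ} {F : ℂ → ℂ}
    (hF : IsSpectral β a b F) {σ : ℂ} (hσ : σ ≠ 0) :
    ∃ (C : ℝ) (M : ℕ), 0 ≤ C ∧ ∀ (w : ℂ) (m : ℝ), 0 < m →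
      m ≤ (σ * (w - a)).im → m ≤ (σ * (w - b)).im → ‖rayInt β F σ w‖ ≤ C * (m ^ M)⁻¹ := by
  obtain ⟨C, c, M, hC, hc, h⟩ := hF.norm_rayFun_le' hβ hσ
  refine ⟨C * ((M + 2).factorial / c ^ (M + 2)) * ∫ r in Ioi (0 : ℝ), (1 + r ^ 2)⁻¹, M + 2, ?_, ?_⟩
  · have : 0 ≤ ∫ r in Ioi (0 : ℝ), (1 + r ^ 2)⁻¹ := integral_nonneg fun r => by positivity
    positivity
  intro w m hm ha hb
  have key : ‖rayInt β F σ w‖ ≤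
      ∫ r in Ioi (0 : ℝ), C * ((M + 2).factorial / (c * m) ^ (M + 2) * (1 + r ^ 2)⁻¹) := by
    refine norm_integral_le_of_norm_le
      (((integrable_inv_one_add_sq.const_mul _).const_mul C).integrableOn) ?_
    filter_upwards [ae_restrict_mem measurableSet_Ioi] with r hr
    refine (h w m hm.le ha hb r hr).trans ?_
    exact mul_le_mul_of_nonneg_left (add_inv_pow_mul_exp_le M (mul_pos hc hm) hr) hC
  refine key.trans_eq ?_
  rw [integral_const_mul, integral_const_mul, mul_pow]
  field_simp

end FokasPolygon

end

/-! ### Differentiation of ray integrals and the modified Helmholtz equation -/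

noncomputable section

namespace FokasPolygon

open MeasureTheory

/-- Multipliers of polynomial growth in `|λ| + 1/|λ|` cost nothing in the exponent. Every derivative
in `w` of a ray integral is therefore again built from ray integrals of spectral functions for the
same segment. -/
theorem IsSpectral.of_norm_le {β : ℝ} {a b : ℂ} {F g : ℂ → ℂ} (hF : IsSpectral β a b F)
    (hg : DifferentiableOn ℂ g {0}ᶜ) {C : ℝ} {M : ℕ} (hC : 0 ≤ C)
    (hb : ∀ l, l ≠ 0 → ‖g l‖ ≤ C * (‖l‖ + ‖l‖⁻¹) ^ M) : IsSpectral β a b fun l => g l * F l := by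
  obtain ⟨h1, C', M', hC', h2⟩ := hF
  refine ⟨hg.mul h1, C * C', M + M', by positivity, fun l hl => ?_⟩
  rw [norm_mul]
  refine (mul_le_mul (hb l hl) (h2 l hl) (norm_nonneg _) (by positivity)).trans_eq ?_
  ring

theorem IsSpectral.const_mul {β : ℝ} {a b : ℂ} {F : ℂ → ℂ} (hF : IsSpectral β a b F) (c : ℂ) :
    IsSpectral β a b fun l => c * F l :=
  hF.of_norm_le (differentiableOn_const c) (norm_nonneg c) (M := 0) (by simp)

theorem IsSpectral.id_mul {β : ℝ} {a b : ℂ} {F : ℂ → ℂ} (hF : IsSpectral β a b F) :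
    IsSpectral β a b fun l => l * F l :=
  hF.of_norm_le differentiableOn_id zero_le_one (M := 1) fun l _ => by simp

theorem IsSpectral.inv_mul {β : ℝ} {a b : ℂ} {F : ℂ → ℂ} (hF : IsSpectral β a b F) :
    IsSpectral β a b fun l => l⁻¹ * F l :=
  hF.of_norm_le (differentiableOn_inv) zero_le_one (M := 1) fun l _ => by simp

theorem IsSpectral.add {β : ℝ} {a b : ℂ} {F G : ℂ → ℂ} (hF : IsSpectral β a b F)
    (hG : IsSpectral β a b G) : IsSpectral β a b fun l => F l + G l := by
  obtain ⟨h1, C, M, hC, h2⟩ := hF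
  obtain ⟨h1', C', M', hC', h2'⟩ := hG
  refine ⟨h1.add h1', C + C', M + M', by positivity, fun l hl => (norm_add_le _ _).trans ?_⟩
  have h0 : 0 < ‖l‖ := norm_pos_iff.2 hl
  -- The base is at least `1`, so both bounds can be raised to the common exponent `M + M'`.
  have h3 : 1 ≤ ‖l‖ + ‖l‖⁻¹ := by
    rcases le_total 1 ‖l‖ with h | h
    · have := inv_pos.2 h0
      linarith
    · have := (one_le_inv₀ h0).2 h
      linarith
  have h4 := pow_le_pow_right₀ h3 (Nat.le_add_right M M')
  have h5 := pow_le_pow_right₀ h3 (Nat.le_add_left M' M)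
  rw [add_mul, add_mul]
  refine add_le_add ((h2 l hl).trans ?_) ((h2' l hl).trans ?_) <;> gcongr

/-- The derivative of `e^{iλw - iβ²w̄/λ}` in the direction `v`, divided by this function. -/
def dirFactor (β : ℝ) (v l : ℂ) : ℂ :=
  Complex.I * l * v - Complex.I * (β : ℂ) ^ 2 * (starRingEnd ℂ) v / l

theorem IsSpectral.dirFactor_mul {β : ℝ} {a b : ℂ} {F : ℂ → ℂ} (hF : IsSpectral β a b F) (v : ℂ) :
    IsSpectral β a b fun l => dirFactor β v l * F l := by
  have := (hF.id_mul.const_mul (Complex.I * v)).add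
    (hF.inv_mul.const_mul (-(Complex.I * (β : ℂ) ^ 2 * (starRingEnd ℂ) v)))
  convert this using 2 with l
  rw [dirFactor]
  ring

theorem hasFDerivAt_rayFun (β : ℝ) (F : ℂ → ℂ) (σ w : ℂ) (r : ℝ) :
    HasFDerivAt (𝕜 := ℝ) (fun w => rayFun β F σ w r)
      (rayFun β (fun l => Complex.I * (l * F l)) σ w r • (1 : ℂ →L[ℝ] ℂ) +
        rayFun β (fun l => -(Complex.I * (β : ℂ) ^ 2) * (l⁻¹ * F l)) σ w r •
          (Complex.conjCLE : ℂ →L[ℝ] ℂ)) w := by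
  have h1 : HasFDerivAt (𝕜 := ℝ) (fun w : ℂ => w) (1 : ℂ →L[ℝ] ℂ) w := hasFDerivAt_id w
  have h2 : HasFDerivAt (𝕜 := ℝ) (fun w : ℂ => (starRingEnd ℂ) w)
    (Complex.conjCLE : ℂ →L[ℝ] ℂ) w := Complex.conjCLE.hasFDerivAt
  have h3 := ((((h1.const_mul (Complex.I * (r * σ))).sub
    (h2.const_mul (Complex.I * (β : ℂ) ^ 2 / (r * σ)))).cexp.mul_const
      (F (r * σ))).mul_const (r * σ : ℂ)⁻¹).mul_const σ
  refine (h3.congr_fderiv ?_).congr_of_eventuallyEq (Eventually.of_forall fun w => ?_)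
  · ext v
    simp [rayFun, rayKernel, div_eq_mul_inv]
    ring_nf
  · simp only [rayFun, rayKernel, Pi.sub_apply, div_eq_mul_inv]
    ring_nf

theorem IsSpectral.hasFDerivAt_rayInt {β : ℝ} (hβ : β ≠ 0) {a b : ℂ} {F : ℂ → ℂ}
    (hF : IsSpectral β a b F) {σ w : ℂ} (hw : w ∈ decayDomain a b σ) :
    HasFDerivAt (𝕜 := ℝ) (rayInt β F σ)
      (rayInt β (fun l => Complex.I * (l * F l)) σ w • (1 : ℂ →L[ℝ] ℂ) +
        rayInt β (fun l => -(Complex.I * (β : ℂ) ^ 2) * (l⁻¹ * F l)) σ w •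
          (Complex.conjCLE : ℂ →L[ℝ] ℂ)) w := by
  have hσ := ne_zero_of_mem_decayDomain hw
  have hF1 := hF.id_mul.const_mul Complex.I
  have hF2 := hF.inv_mul.const_mul (-(Complex.I * (β : ℂ) ^ 2))
  obtain ⟨C1, c1, M1, hC1, hc1, b1⟩ := hF1.norm_rayFun_le' hβ hσ
  obtain ⟨C2, c2, M2, hC2, hc2, b2⟩ := hF2.norm_rayFun_le' hβ hσ
  -- Any `m` strictly below both heights at `w` stays below them nearby, which gives a dominating
  -- function independent of the point.
  obtain ⟨m, hm0, hm⟩ := exists_between (lt_min hw.1 hw.2)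
  rw [lt_min_iff] at hm
  have hs : {w | m < (σ * (w - a)).im ∧ m < (σ * (w - b)).im} ∈ 𝓝 w :=
    ((isOpen_lt continuous_const (g := fun w : ℂ => (σ * (w - a)).im) (by fun_prop)).inter
    (isOpen_lt continuous_const (g := fun w : ℂ => (σ * (w - b)).im) (by fun_prop))).mem_nhds hm
  have i1 := hF1.integrableOn_rayFun hβ hw
  have i2 := hF2.integrableOn_rayFun hβ hw
  have hmeas : AEStronglyMeasurable
      (fun r => rayFun β (fun l => Complex.I * (l * F l)) σ w r • (1 : ℂ →L[ℝ] ℂ) +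
        rayFun β (fun l => -(Complex.I * (β : ℂ) ^ 2) * (l⁻¹ * F l)) σ w r •
          (Complex.conjCLE : ℂ →L[ℝ] ℂ)) (volume.restrict (Ioi 0)) :=
    (i1.aestronglyMeasurable.smul_const _).add (i2.aestronglyMeasurable.smul_const _)
  have key := hasFDerivAt_integral_of_dominated_of_fderiv_le (𝕜 := ℝ)
    (F := fun w r => rayFun β F σ w r)
    (F' := fun w r => rayFun β (fun l => Complex.I * (l * F l)) σ w r • (1 : ℂ →L[ℝ] ℂ) +
        rayFun β (fun l => -(Complex.I * (β : ℂ) ^ 2) * (l⁻¹ * F l)) σ w r •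
          (Complex.conjCLE : ℂ →L[ℝ] ℂ)) (μ := volume.restrict (Ioi 0)) (x₀ := w)
    (bound := fun r => C1 * ((r + r⁻¹) ^ M1 * Real.exp (-(c1 * m * (r + r⁻¹)))) +
      C2 * ((r + r⁻¹) ^ M2 * Real.exp (-(c2 * m * (r + r⁻¹))))) hs
    (Eventually.of_forall fun w => hF.aestronglyMeasurable_rayFun hσ w)
    (hF.integrableOn_rayFun hβ hw)
    hmeas ?_
    (((integrableOn_add_inv_pow_mul_exp M1 (mul_pos hc1 hm0)).const_mul C1).add
      ((integrableOn_add_inv_pow_mul_exp M2 (mul_pos hc2 hm0)).const_mul C2))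
    (Eventually.of_forall fun r w _ => hasFDerivAt_rayFun β F σ w r)
  · refine key.congr_fderiv ?_
    rw [integral_add (i1.smul_const _) (i2.smul_const _), integral_smul_const, integral_smul_const]
    rfl
  · filter_upwards [ae_restrict_mem measurableSet_Ioi] with r hr w' hw'
    refine (norm_add_le _ _).trans (add_le_add ?_ ?_)
    · rw [norm_smul, norm_one, mul_one]
      exact b1 w' m hm0.le hw'.1.le hw'.2.le r hr
    · rw [norm_smul, Complex.conjCLE_norm, mul_one]
      exact b2 w' m hm0.le hw'.1.le hw'.2.le r hr

theorem IsSpectral.fderiv_rayInt {β : ℝ} (hβ : β ≠ 0) {a b : ℂ} {F : ℂ → ℂ}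
    (hF : IsSpectral β a b F) {σ w : ℂ} (hw : w ∈ decayDomain a b σ) (v : ℂ) :
    fderiv ℝ (rayInt β F σ) w v = rayInt β (fun l => dirFactor β v l * F l) σ w := by
  have i1 := (hF.id_mul.const_mul Complex.I).integrableOn_rayFun hβ hw
  have i2 := (hF.inv_mul.const_mul (-(Complex.I * (β : ℂ) ^ 2))).integrableOn_rayFun hβ hw
  rw [(hF.hasFDerivAt_rayInt hβ hw).fderiv]
  simp only [add_apply, smul_apply, one_apply_eq_self, ContinuousLinearEquiv.coe_coe,
    Complex.conjCLE_apply, smul_eq_mul]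
  unfold rayInt
  rw [← integral_mul_const, ← integral_mul_const,
    ← integral_add (i1.mul_const _) (i2.mul_const _)]
  refine integral_congr_ae (Eventually.of_forall fun r => ?_)
  simp only [rayFun, rayKernel, dirFactor, div_eq_mul_inv]
  ring

/-- Induction on the order with `F` general: the derivative consists of ray integrals of `λF` and
`λ⁻¹F`, up to constants. -/
theorem IsSpectral.contDiffOn_rayInt {β : ℝ} (hβ : β ≠ 0) {a b : ℂ} {F : ℂ → ℂ}
    (hF : IsSpectral β a b F) (σ : ℂ) :
    ContDiffOn ℝ ∞ (rayInt β F σ) (decayDomain a b σ) := by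
  rw [contDiffOn_infty]
  intro n
  induction n generalizing F with
  | zero =>
    exact contDiffOn_zero.2 fun w hw =>
      (hF.hasFDerivAt_rayInt hβ hw).continuousAt.continuousWithinAt
  | succ n ih =>
    rw [Nat.cast_succ, contDiffOn_succ_iff_fderiv_of_isOpen (isOpen_decayDomain a b σ)]
    refine ⟨fun w hw =>
      (hF.hasFDerivAt_rayInt hβ hw).differentiableAt.differentiableWithinAt, by simp, ?_⟩
    refine ContDiffOn.congr ?_ fun w hw => (hF.hasFDerivAt_rayInt hβ hw).fderiv
    exact ((ih (hF.id_mul.const_mul Complex.I)).smul contDiffOn_const).add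
      ((ih (hF.inv_mul.const_mul (-(Complex.I * (β : ℂ) ^ 2)))).smul contDiffOn_const)

theorem IsSpectral.continuousAt_rayInt {β : ℝ} (hβ : β ≠ 0) {a b : ℂ} {F : ℂ → ℂ}
    (hF : IsSpectral β a b F) {σ w : ℂ} (hw : w ∈ decayDomain a b σ) :
    ContinuousAt (rayInt β F σ) w := (hF.hasFDerivAt_rayInt hβ hw).continuousAt

/-- The symbols of the derivatives in the directions `1` and `i` are `i(λ - β²/λ)` and `-(λ +
β²/λ)`; their squares add up to `4β²`. -/
theorem IsSpectral.laplacian_rayInt {β : ℝ} (hβ : β ≠ 0) {a b : ℂ} {F : ℂ → ℂ}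
    (hF : IsSpectral β a b F) {σ w : ℂ} (hw : w ∈ decayDomain a b σ) :
    Laplacian.laplacian (rayInt β F σ) w = 4 * (β : ℂ) ^ 2 * rayInt β F σ w := by
  have hd : ∀ v : ℂ, iteratedFDeriv ℝ 2 (rayInt β F σ) w ![v, v] =
      rayInt β (fun l => dirFactor β v l * (dirFactor β v l * F l)) σ w := by
    intro v
    rw [iteratedFDeriv_two_apply]
    have h1 : (fun w => fderiv ℝ (rayInt β F σ) w v) =ᶠ[𝓝 w]
        rayInt β (fun l => dirFactor β v l * F l) σ := by
      filter_upwards [(isOpen_decayDomain a b σ).mem_nhds hw] with x hx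
      exact hF.fderiv_rayInt hβ hx v
    have h2 : DifferentiableAt ℝ (fderiv ℝ (rayInt β F σ)) w := by
      have := (contDiffOn_infty.1 (hF.contDiffOn_rayInt hβ σ) 2).contDiffAt
        ((isOpen_decayDomain a b σ).mem_nhds hw)
      exact (this.fderiv_right (m := 1) (by norm_num)).differentiableAt one_ne_zero
    rw [← (hF.dirFactor_mul v).fderiv_rayInt hβ hw v, ← h1.fderiv_eq,
      fderiv_clm_apply h2 (differentiableAt_const v)]
    simp
  rw [InnerProductSpace.laplacian_eq_iteratedFDeriv_complexPlane]
  simp only [hd]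
  unfold rayInt
  rw [← integral_const_mul, ← integral_add]
  · refine setIntegral_congr_fun measurableSet_Ioi fun r hr => ?_
    have hl : (r * σ : ℂ) ≠ 0 := mul_ne_zero (by exact_mod_cast (ne_of_gt hr))
      (ne_zero_of_mem_decayDomain hw)
    have h3 : dirFactor β 1 (r * σ) ^ 2 + dirFactor β Complex.I (r * σ) ^ 2 = 4 * (β : ℂ) ^ 2 := by
      simp only [dirFactor, map_one, Complex.conj_I]
      set l : ℂ := r * σ
      field_simp
      ring_nf
      simp only [Complex.I_sq, show Complex.I ^ 4 = 1 from Complex.I_pow_four]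
      ring
    simp only [rayFun, rayKernel]
    rw [← h3]
    ring
  · exact ((hF.dirFactor_mul 1).dirFactor_mul 1).integrableOn_rayFun hβ hw
  · exact ((hF.dirFactor_mul _).dirFactor_mul _).integrableOn_rayFun hβ hw

end FokasPolygon

end

noncomputable section

namespace FokasPolygon

open MeasureTheory

/-! ### Rotation of the ray of integration -/

/-- The directions `σ` for which the ray integral at the point `w` decays. -/
def decayDirections (a b w : ℂ) : Set ℂ := {σ | w ∈ decayDomain a b σ}

theorem convex_decayDirections (a b w : ℂ) : Convex ℝ (decayDirections a b w) := by
  have h : ∀ x : ℂ, Convex ℝ {σ : ℂ | 0 < (σ * x).im} := fun x =>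
    convex_halfSpace_gt (f := fun σ : ℂ => (σ * x).im)
      ⟨fun s t => by simp [add_mul], fun c s => by simp; ring⟩ 0
  exact (h (w - a)).inter (h (w - b))

theorem isOpen_decayDirections (a b w : ℂ) : IsOpen (decayDirections a b w) :=
  (isOpen_lt continuous_const (g := fun σ : ℂ => (σ * (w - a)).im) (by fun_prop)).inter
    (isOpen_lt continuous_const (g := fun σ : ℂ => (σ * (w - b)).im) (by fun_prop))

theorem IsSpectral.differentiableOn_rayKernel {β : ℝ} {a b : ℂ} {F : ℂ → ℂ}
    (hF : IsSpectral β a b F) (w : ℂ) : DifferentiableOn ℂ (rayKernel β F w) {0}ᶜ := by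
  have h0 : ∀ l ∈ ({0}ᶜ : Set ℂ), l ≠ 0 := fun l hl => hl
  unfold rayKernel
  exact (((((differentiableOn_id.const_mul _).mul_const _).sub
    (DifferentiableOn.div (differentiableOn_const _) differentiableOn_id h0)).cexp).mul hF.1).div
    differentiableOn_id h0

theorem IsSpectral.hasDerivAt_rayFun {β : ℝ} {a b : ℂ} {F : ℂ → ℂ}
    (hF : IsSpectral β a b F) (w : ℂ) {σ : ℂ} (hσ : σ ≠ 0) {r : ℝ} (hr : 0 < r) :
    HasDerivAt (fun σ => rayFun β F σ w r)
      (deriv (rayKernel β F w) (r * σ) * r * σ + rayKernel β F w (r * σ)) σ := by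
  have hl : (r * σ : ℂ) ≠ 0 := mul_ne_zero (by exact_mod_cast hr.ne') hσ
  have h1 : HasDerivAt (rayKernel β F w) (deriv (rayKernel β F w) (r * σ)) (r * σ) :=
    ((hF.differentiableOn_rayKernel w).differentiableAt
      (isOpen_compl_singleton.mem_nhds hl)).hasDerivAt
  have h2 : HasDerivAt (fun σ : ℂ => (r : ℂ) * σ) r σ := by
    simpa using (hasDerivAt_id σ).const_mul (r : ℂ)
  have h3 := (HasDerivAt.comp σ h1 h2).mul (hasDerivAt_id σ)
  simpa using! h3

/-- The integrand is holomorphic in `σ`. Cauchy's estimate on small discs converts its bound,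
uniform over an annulus, into a dominating function for its `σ`-derivative. -/
theorem IsSpectral.differentiableAt_rayInt_direction {β : ℝ} (hβ : β ≠ 0) {a b : ℂ} {F : ℂ → ℂ}
    (hF : IsSpectral β a b F) {w σ : ℂ} (hσ : σ ∈ decayDirections a b w) :
    DifferentiableAt ℂ (fun σ => rayInt β F σ w) σ := by
  have hσ0 : σ ≠ 0 := ne_zero_of_mem_decayDomain hσ
  obtain ⟨m, hm0, hm⟩ := exists_between (lt_min hσ.1 hσ.2)
  rw [lt_min_iff] at hm
  have hn : 0 < ‖σ‖ := norm_pos_iff.2 hσ0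
  -- The factors `2` place `σ` in the open annulus, so the bound holds on a neighbourhood of `σ`.
  set K := 2 * ‖σ‖ + 2 * ‖σ‖⁻¹ with hK
  have hK0 : 0 < K := by positivity
  have hK1 : ‖σ‖ < K := by have := inv_pos.2 hn; linarith
  have hK2 : K⁻¹ < ‖σ‖ := by
    rw [inv_lt_comm₀ hK0 hn]; have := inv_pos.2 hn; linarith
  have hs : {s : ℂ | (m < (s * (w - a)).im ∧ m < (s * (w - b)).im) ∧
      (K⁻¹ < ‖s‖ ∧ ‖s‖ < K)} ∈ 𝓝 σ := by
    refine IsOpen.mem_nhds ?_ ⟨hm, hK2, hK1⟩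
    exact ((isOpen_lt continuous_const (g := fun s : ℂ => (s * (w - a)).im) (by fun_prop)).inter
      (isOpen_lt continuous_const (g := fun s : ℂ => (s * (w - b)).im) (by fun_prop))).inter
      ((isOpen_lt continuous_const continuous_norm).inter
        (isOpen_lt continuous_norm continuous_const))
  obtain ⟨ε, hε, hball⟩ := Metric.mem_nhds_iff.1 hs
  obtain ⟨C, c, M, hC, hc, hb⟩ := hF.norm_rayFun_le hβ hK0
  -- Discs of radius `δ` centred in the `δ`-ball reach distance at most `2ε/3`, so they stay where
  -- the bound holds.
  set δ := ε / 3 with hδ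
  have hδ0 : 0 < δ := by positivity
  have hsub : ∀ x ∈ Metric.ball σ δ, Metric.closedBall x δ ⊆ Metric.ball σ ε := by
    intro x hx y hy
    rw [Metric.mem_ball] at hx ⊢
    rw [Metric.mem_closedBall] at hy
    linarith [dist_triangle y x σ]
  have hbound : ∀ y ∈ Metric.ball σ ε, ∀ r : ℝ, 0 < r →
      ‖rayFun β F y w r‖ ≤ C * ((r + r⁻¹) ^ M * Real.exp (-(c * m * (r + r⁻¹)))) := fun y hy r hr =>
    have h := hball hy
    hb y h.2.1.le h.2.2.le w m hm0.le h.1.1.le h.1.2.le r hr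
  have hne : ∀ y ∈ Metric.ball σ ε, y ≠ 0 := fun y hy =>
    norm_pos_iff.1 ((inv_pos.2 hK0).trans (hball hy).2.1)
  have hmul : ∀ r ∈ Ioi (0 : ℝ), (r * σ : ℂ) ≠ 0 := fun r hr =>
    mul_ne_zero (by exact_mod_cast (ne_of_gt hr)) hσ0
  have hcomp : ∀ {g : ℂ → ℂ}, ContinuousOn g {0}ᶜ →
      ContinuousOn (fun r : ℝ => g (r * σ)) (Ioi 0) := fun hg =>
    hg.comp (by fun_prop) hmul
  have hK' := hF.differentiableOn_rayKernel w
  refine (hasDerivAt_integral_of_dominated_loc_of_deriv_le (𝕜 := ℂ)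
    (F := fun σ r => rayFun β F σ w r)
    (F' := fun σ r => deriv (rayKernel β F w) (r * σ) * r * σ + rayKernel β F w (r * σ))
    (μ := volume.restrict (Ioi 0))
    (bound := fun r => (C * ((r + r⁻¹) ^ M * Real.exp (-(c * m * (r + r⁻¹))))) / δ)
    (Metric.ball_mem_nhds σ hδ0) ?_ (hF.integrableOn_rayFun hβ hσ) ?_ ?_ ?_
    ?_).2.differentiableAt
  · filter_upwards [isOpen_compl_singleton.mem_nhds hσ0] with s hs
    exact hF.aestronglyMeasurable_rayFun hs w
  · refine ContinuousOn.aestronglyMeasurable ?_ measurableSet_Ioi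
    have h1 := hcomp (hK'.deriv isOpen_compl_singleton).continuousOn
    have h2 := hcomp hK'.continuousOn
    exact ((h1.mul (by fun_prop)).mul (by fun_prop)).add h2
  · filter_upwards [ae_restrict_mem measurableSet_Ioi] with r hr x hx
    have hxb : x ∈ Metric.ball σ ε := hsub x hx (Metric.mem_closedBall_self hδ0.le)
    rw [← (hF.hasDerivAt_rayFun w (hne x hxb) hr).deriv]
    refine Complex.norm_deriv_le_of_forall_mem_sphere_norm_le hδ0 ?_ fun y hy =>
      hbound y (hsub x hx (Metric.sphere_subset_closedBall hy)) r hr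
    refine DifferentiableOn.diffContOnCl fun y hy => ?_
    rw [closure_ball _ hδ0.ne'] at hy
    exact (hF.hasDerivAt_rayFun w (hne y (hsub x hx hy))
      hr).differentiableAt.differentiableWithinAt
  · exact (((integrableOn_add_inv_pow_mul_exp M (mul_pos hc hm0)).const_mul C).div_const δ)
  · filter_upwards [ae_restrict_mem measurableSet_Ioi] with r hr x hx
    exact hF.hasDerivAt_rayFun w (hne x (hsub x hx (Metric.mem_closedBall_self hδ0.le))) hr

theorem rayInt_smul_direction (β : ℝ) (F : ℂ → ℂ) (σ w : ℂ) {c : ℝ} (hc : 0 < c) :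
    rayInt β F (c * σ) w = rayInt β F σ w := by
  have h := integral_comp_mul_left_Ioi (fun r => rayFun β F σ w r) 0 hc
  rw [mul_zero] at h
  unfold rayInt
  rw [← one_smul ℝ (∫ r in Ioi (0 : ℝ), rayFun β F σ w r), ← mul_inv_cancel₀ hc.ne', mul_smul, ← h,
    ← integral_smul]
  refine integral_congr_ae (Eventually.of_forall fun r => ?_)
  simp only [rayFun, Complex.real_smul]
  push_cast
  rw [show (r : ℂ) * (c * σ) = c * r * σ by ring]
  ring

/-- The ray integrals at `w` over all rays along which they decay coincide. -/
theorem IsSpectral.rayInt_eq_rayInt {β : ℝ} (hβ : β ≠ 0) {a b : ℂ} {F : ℂ → ℂ}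
    (hF : IsSpectral β a b F) {w σ σ' : ℂ} (hσ : w ∈ decayDomain a b σ)
    (hσ' : w ∈ decayDomain a b σ') : rayInt β F σ w = rayInt β F σ' w := by
  have hd : ∀ s ∈ decayDirections a b w, DifferentiableAt ℂ (fun σ => rayInt β F σ w) s :=
    fun s hs => hF.differentiableAt_rayInt_direction hβ hs
  refine (isOpen_decayDirections a b w).is_const_of_deriv_eq_zero
    (convex_decayDirections a b w).isPreconnected
    (fun s hs => (hd s hs).differentiableWithinAt) (fun s hs => ?_) hσ hσ'
  -- This replaces a contour argument with arcs. The integral is holomorphic in `σ` and unchanged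
  -- when `σ` is multiplied by a positive real, so its derivative along `s`, namely `s` times the
  -- complex derivative, is zero. The set of decaying directions is convex, hence connected.
  have h1 : HasDerivAt (fun c : ℝ => rayInt β F (c * s) w)
      (deriv (fun σ => rayInt β F σ w) s * s) 1 := by
    have h2 : HasDerivAt (fun c : ℝ => (c : ℂ) * s) s 1 := by
      simpa using (HasDerivAt.ofReal_comp (hasDerivAt_id (1 : ℝ))).mul_const s
    have h3 : HasDerivAt (fun σ => rayInt β F σ w) (deriv (fun σ => rayInt β F σ w) s)
        (((1 : ℝ) : ℂ) * s) := by
      simpa using (hd s hs).hasDerivAt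
    exact HasDerivAt.comp (1 : ℝ) h3 h2
  have h4 : HasDerivAt (fun c : ℝ => rayInt β F (c * s) w) 0 1 := by
    refine (hasDerivAt_const (1 : ℝ) (rayInt β F s w)).congr_of_eventuallyEq ?_
    filter_upwards [lt_mem_nhds zero_lt_one] with c hc
    exact rayInt_smul_direction β F s w hc
  exact (mul_eq_zero.1 (h1.unique h4)).resolve_right (ne_zero_of_mem_decayDomain hs)

end FokasPolygon

end

noncomputable section

namespace FokasPolygon

/-! ### Geometry of the polygon -/

theorem cyclic_succ_ne {n : ℕ} [NeZero n] (h3 : 3 ≤ n) (i : Fin n) : i + 1 ≠ i := by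
  have h1 : ((1 : Fin n) : ℕ) = 1 := by rw [Fin.val_one', Nat.mod_eq_of_lt (by omega)]
  rw [Ne, add_eq_left, Fin.ext_iff, h1]
  simp

theorem cyclic_succ_succ_ne {n : ℕ} [NeZero n] (h3 : 3 ≤ n) (i : Fin n) :
    i + 1 + 1 ≠ i := by
  have h1 : ((1 : Fin n) : ℕ) = 1 := by rw [Fin.val_one', Nat.mod_eq_of_lt (by omega)]
  rw [Ne, add_assoc, add_eq_left, Fin.ext_iff, Fin.val_add, h1, Nat.mod_eq_of_lt (by omega)]
  simp

variable {n : ℕ} [NeZero n]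

/-- The direction `e^{-iα_i}` of the ray `ℓ_i`. -/
def sideDir (z : Fin n → ℂ) (i : Fin n) : ℂ := Complex.exp (-Complex.I * sideAngle z i)

/-- The signed distance to the line through the side `Γ_i`, positive inside the polygon. -/
def signedDist (z : Fin n → ℂ) (i : Fin n) (w : ℂ) : ℝ := (sideDir z i * (w - z i)).im

theorem norm_sideDir (z : Fin n → ℂ) (i : Fin n) : ‖sideDir z i‖ = 1 := by
  rw [sideDir, Complex.norm_exp]
  simp

theorem conj_sideDir (z : Fin n → ℂ) (i : Fin n) :
    (starRingEnd ℂ) (sideDir z i) = Complex.exp (Complex.I * sideAngle z i) := by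
  rw [sideDir, ← Complex.exp_conj]
  simp

theorem sideDir_mul_conj (z : Fin n → ℂ) (i : Fin n) :
    sideDir z i * (starRingEnd ℂ) (sideDir z i) = 1 := by
  rw [Complex.mul_conj, Complex.normSq_eq_norm_sq, norm_sideDir]
  simp

theorem sub_eq_sideLength_mul (z : Fin n → ℂ) (i : Fin n) :
    z (i + 1) - z i = sideLength z i * (starRingEnd ℂ) (sideDir z i) := by
  rw [conj_sideDir, sideLength, sideAngle, mul_comm Complex.I, Complex.norm_mul_exp_arg_mul_I]

theorem sideDir_mul_sub (z : Fin n → ℂ) (i : Fin n) :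
    sideDir z i * (z (i + 1) - z i) = sideLength z i := by
  rw [sub_eq_sideLength_mul, mul_left_comm, sideDir_mul_conj, mul_one]

theorem signedDist_self (z : Fin n → ℂ) (i : Fin n) : signedDist z i (z i) = 0 := by
  simp [signedDist]

theorem signedDist_succ (z : Fin n → ℂ) (i : Fin n) : signedDist z i (z (i + 1)) = 0 := by
  rw [signedDist, sideDir_mul_sub, Complex.ofReal_im]

/-- `signedDist` is 1-Lipschitz because `sideDir` is unimodular. This is the link with
`Metric.infDist`. -/
theorem signedDist_sub_le (z : Fin n → ℂ) (i : Fin n) (w y : ℂ) :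
    signedDist z i w - signedDist z i y ≤ dist w y := by
  have h : signedDist z i w - signedDist z i y = (sideDir z i * (w - y)).im := by
    rw [signedDist, signedDist, ← Complex.sub_im]
    congr 1
    ring
  rw [h, dist_eq_norm, ← one_mul ‖w - y‖, ← norm_sideDir z i, ← norm_mul]
  exact Complex.im_le_norm _

theorem continuous_signedDist (z : Fin n → ℂ) (i : Fin n) : Continuous (signedDist z i) := by
  unfold signedDist
  fun_prop

/-- `signedDist` is affine. -/
theorem signedDist_lineMap (z : Fin n → ℂ) (j : Fin n) (a b v : ℂ) (x : ℝ) :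
    signedDist z j (a + x * (b - a) + v) =
      (1 - x) * signedDist z j a + x * signedDist z j b + (sideDir z j * v).im := by
  simp only [signedDist]
  rw [show sideDir z j * (a + x * (b - a) + v - z j) =
    ((1 - x : ℝ) : ℂ) * (sideDir z j * (a - z j)) + (x : ℂ) * (sideDir z j * (b - z j)) +
      sideDir z j * v by push_cast; ring]
  rw [Complex.add_im, Complex.add_im, Complex.im_ofReal_mul, Complex.im_ofReal_mul]

/-- The point with abscissa `x` along `Γ_i` (normalised to `[0,1]`) and height `t` above it. -/
def sidePoint (z : Fin n → ℂ) (i : Fin n) (x t : ℝ) : ℂ :=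
  z i + x * (z (i + 1) - z i) + t * (Complex.I * (starRingEnd ℂ) (sideDir z i))

/-- The cosine of the angle between the sides `Γ_i` and `Γ_j`. -/
def sideCos (z : Fin n → ℂ) (i j : Fin n) : ℝ :=
  (sideDir z j * (starRingEnd ℂ) (sideDir z i)).re

theorem abs_sideCos_le (z : Fin n → ℂ) (i j : Fin n) : |sideCos z i j| ≤ 1 := by
  refine (Complex.abs_re_le_norm _).trans ?_
  rw [norm_mul, RCLike.norm_conj, norm_sideDir, norm_sideDir, mul_one]

theorem sideCos_self (z : Fin n → ℂ) (i : Fin n) : sideCos z i i = 1 := by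
  rw [sideCos, sideDir_mul_conj, Complex.one_re]

theorem signedDist_sidePoint (z : Fin n → ℂ) (i j : Fin n) (x t : ℝ) :
    signedDist z j (sidePoint z i x t) = (1 - x) * signedDist z j (z i) +
      x * signedDist z j (z (i + 1)) + t * sideCos z i j := by
  rw [sidePoint, signedDist_lineMap, sideCos]
  congr 1
  rw [show sideDir z j * (t * (Complex.I * (starRingEnd ℂ) (sideDir z i))) =
    (t : ℂ) * (Complex.I * (sideDir z j * (starRingEnd ℂ) (sideDir z i))) by ring,
    Complex.im_ofReal_mul, Complex.I_mul_im]

theorem signedDist_sidePoint_self (z : Fin n → ℂ) (i : Fin n) (x t : ℝ) :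
    signedDist z i (sidePoint z i x t) = t := by
  rw [signedDist_sidePoint, signedDist_self, signedDist_succ, sideCos_self]
  ring

namespace IsConvexPolygon

variable {z : Fin n → ℂ}

theorem signedDist_pos (hz : IsConvexPolygon z) {i j : Fin n} (h1 : j ≠ i) (h2 : j ≠ i + 1) :
    0 < signedDist z i (z j) := by
  have h := hz.2 i j h1 h2
  rw [sub_eq_sideLength_mul, map_mul, Complex.conj_conj, Complex.conj_ofReal, mul_assoc,
    Complex.im_ofReal_mul] at h
  exact pos_of_mul_pos_right h (norm_nonneg _)

theorem signedDist_nonneg (hz : IsConvexPolygon z) (i j : Fin n) : 0 ≤ signedDist z i (z j) := by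
  by_cases h1 : j = i
  · rw [h1, signedDist_self]
  by_cases h2 : j = i + 1
  · rw [h2, signedDist_succ]
  exact (hz.signedDist_pos h1 h2).le

theorem sideLength_pos (hz : IsConvexPolygon z) (i : Fin n) : 0 < sideLength z i := by
  refine (norm_nonneg _).lt_of_ne fun h => ?_
  have h0 : z (i + 1) - z i = 0 := norm_eq_zero.1 h.symm
  have := hz.2 i (i + 1 + 1) (cyclic_succ_succ_ne hz.1 i) (cyclic_succ_ne hz.1 (i + 1))
  rw [h0] at this
  simp at this

theorem signedDist_eq_div (hz : IsConvexPolygon z) (i : Fin n) (w : ℂ) :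
    signedDist z i w =
      ((starRingEnd ℂ) (z (i + 1) - z i) * (w - z i)).im / sideLength z i := by
  rw [eq_div_iff (hz.sideLength_pos i).ne', sub_eq_sideLength_mul, map_mul, Complex.conj_conj,
    Complex.conj_ofReal, mul_assoc, Complex.im_ofReal_mul, mul_comm]
  rfl

theorem signedDist_eq_div_succ (hz : IsConvexPolygon z) (i : Fin n) (w : ℂ) :
    signedDist z i w =
      ((starRingEnd ℂ) (z (i + 1) - z i) * (w - z (i + 1))).im / sideLength z i := by
  rw [signedDist_eq_div hz]
  congr 1
  rw [show w - z i = (z (i + 1) - z i) + (w - z (i + 1)) by ring, mul_add, Complex.add_im,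
    ← Complex.normSq_eq_conj_mul_self, Complex.ofReal_im, zero_add]

/-- Cramer's rule in the plane, cleared of denominators. -/
theorem _root_.FokasPolygon.cramer (e e' v : ℂ) : ((((starRingEnd ℂ) e * e').im : ℝ) : ℂ) * v =
    ((((starRingEnd ℂ) (-e') * v).im : ℝ) : ℂ) * e +
      ((((starRingEnd ℂ) e * v).im : ℝ) : ℂ) * e' := by
  apply Complex.ext <;> simp <;> ring

/-- The line of `Γ_j` passes through at most one endpoint of another side. Hence the height above it
is positive on the open side `Γ_i`. -/
theorem signedDist_add_pos (hz : IsConvexPolygon z) {i j : Fin n} (hij : j ≠ i) :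
    0 < signedDist z j (z i) ∨ 0 < signedDist z j (z (i + 1)) := by
  by_cases h : i = j + 1
  · refine Or.inr (hz.signedDist_pos ?_ ?_)
    · rw [h]; exact cyclic_succ_succ_ne hz.1 j
    · rw [← h]; exact cyclic_succ_ne hz.1 i
  · exact Or.inl (hz.signedDist_pos hij.symm h)

/-- Only one inclusion has content. Separate a point `w` of all half-planes from the hull by a
linear form `f`, and choose a vertex where `f` is minimal. There `f` is nonnegative on both adjacent
edges, and `w` lies in the cone they span, so `f w` is at least the value at the vertex, contrary to
separation. -/
theorem convexHull_eq (hz : IsConvexPolygon z) :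
    convexHull ℝ (range z) = {w | ∀ i, 0 ≤ signedDist z i w} := by
  refine Subset.antisymm (convexHull_min ?_ ?_) fun w hw => ?_
  · rintro _ ⟨j, rfl⟩ i
    exact hz.signedDist_nonneg i j
  · rw [ofPred_forall]
    refine convex_iInter fun i x hx y hy a b ha hb hab => ?_
    have : a • x + b • y = x + b * (y - x) + 0 := by
      have ha' : (a : ℂ) = 1 - b := by
        rw [eq_sub_iff_add_eq]
        exact_mod_cast hab
      rw [Complex.real_smul, Complex.real_smul, ha']
      ring
    rw [mem_ofPred_eq, this, signedDist_lineMap, mul_zero, Complex.zero_im, add_zero, ← hab,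
      add_sub_cancel_right]
    exact add_nonneg (mul_nonneg ha hx) (mul_nonneg hb hy)
  · by_contra hcon
    obtain ⟨f, u, hfw, hf⟩ := geometric_hahn_banach_point_closed (convex_convexHull ℝ (range z))
      ((finite_range z).isCompact_convexHull ℝ).isClosed hcon
    obtain ⟨k', hk'⟩ := Finite.exists_min fun j => f (z j)
    obtain ⟨k, rfl⟩ : ∃ k, k + 1 = k' := ⟨k' - 1, sub_add_cancel _ _⟩
    have hu : u < f (z (k + 1)) := hf _ (subset_convexHull ℝ _ (mem_range_self _))
    set e := z (k + 1 + 1) - z (k + 1) with he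
    set e' := z k - z (k + 1) with he'
    have hp : 0 < signedDist z k (z (k + 1 + 1)) := hz.signedDist_pos
      (cyclic_succ_succ_ne hz.1 k) (cyclic_succ_ne hz.1 (k + 1))
    have hq : 0 < signedDist z (k + 1) (z k) := hz.signedDist_pos
      (cyclic_succ_ne hz.1 k).symm (cyclic_succ_succ_ne hz.1 k).symm
    have hfe : 0 ≤ f e := by rw [he, map_sub, sub_nonneg]; exact hk' _
    have hfe' : 0 ≤ f e' := by rw [he', map_sub, sub_nonneg]; exact hk' _
    -- Each coordinate of `w - z (k + 1)` along an adjacent edge is the height of `w` above the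
    -- other edge's line, normalised by the height of the neighbouring vertex.
    have hdecomp : w - z (k + 1) =
        (signedDist z k w / signedDist z k (z (k + 1 + 1))) • e +
          (signedDist z (k + 1) w / signedDist z (k + 1) (z k)) • e' := by
      have hD : ((starRingEnd ℂ) (-e') * e).im = ((starRingEnd ℂ) e * e').im := by
        simp
        ring
      have hD0 : ((starRingEnd ℂ) e * e').im ≠ 0 := by
        have h1 := signedDist_eq_div_succ hz k (z (k + 1 + 1))
        rw [show z (k + 1) - z k = -e' by rw [he']; ring, ← he, hD] at h1
        intro h0
        rw [h1, h0, zero_div] at hp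
        exact hp.false
      have hL := (hz.sideLength_pos k).ne'
      have hL' := (hz.sideLength_pos (k + 1)).ne'
      rw [signedDist_eq_div_succ hz k, signedDist_eq_div_succ hz k, signedDist_eq_div hz (k + 1),
        signedDist_eq_div hz (k + 1), div_div_div_cancel_right₀ hL, div_div_div_cancel_right₀ hL',
        show z (k + 1) - z k = -e' by rw [he']; ring, ← he, ← he', hD]
      have h := cramer e e' (w - z (k + 1))
      rw [Complex.real_smul, Complex.real_smul]
      push_cast
      have hD1 : ((((starRingEnd ℂ) e * e').im : ℝ) : ℂ) ≠ 0 := by exact_mod_cast hD0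
      rw [div_mul_eq_mul_div, div_mul_eq_mul_div, ← add_div, ← h, mul_div_cancel_left₀ _ hD1]
    have : 0 ≤ f (w - z (k + 1)) := by
      rw [hdecomp, map_add, map_smul, map_smul, smul_eq_mul, smul_eq_mul]
      exact add_nonneg (mul_nonneg (div_nonneg (hw k) hp.le) hfe)
        (mul_nonneg (div_nonneg (hw (k + 1)) hq.le) hfe')
    rw [map_sub] at this
    linarith

/-- Otherwise a step along the outward normal, longer than the height but shorter than `δ`, would
end at negative height inside the ball. -/
theorem _root_.FokasPolygon.le_signedDist_of_ball (z : Fin n → ℂ) {w : ℂ} {δ : ℝ} (hδ : 0 < δ)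
    (i : Fin n)
    (h : ∀ y ∈ Metric.ball w δ, 0 ≤ signedDist z i y) : δ ≤ signedDist z i w := by
  by_contra! hlt
  obtain ⟨t, ht1, ht2⟩ := exists_between hlt
  have ht0 : 0 ≤ t := (h w (Metric.mem_ball_self hδ)).trans ht1.le
  have h1 := h (w - t * (Complex.I * (starRingEnd ℂ) (sideDir z i))) (by
    rw [Metric.mem_ball, dist_eq_norm, sub_sub_cancel_left, norm_neg, norm_mul, norm_mul,
      Complex.norm_I, RCLike.norm_conj, norm_sideDir, Complex.norm_of_nonneg ht0]
    linarith)
  have h2 : signedDist z i (w - t * (Complex.I * (starRingEnd ℂ) (sideDir z i))) =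
      signedDist z i w - t := by
    simp only [signedDist]
    rw [show sideDir z i * (w - t * (Complex.I * (starRingEnd ℂ) (sideDir z i)) - z i) =
      sideDir z i * (w - z i) -
        t * (Complex.I * (sideDir z i * (starRingEnd ℂ) (sideDir z i))) by ring,
      sideDir_mul_conj, Complex.sub_im]
    simp
  linarith

theorem interiorDomain_eq (hz : IsConvexPolygon z) :
    interiorDomain z = {w | ∀ i, 0 < signedDist z i w} := by
  rw [interiorDomain, hz.convexHull_eq]
  refine Subset.antisymm (fun w hw i => ?_) (interior_maximal (fun w hw i => (hw i).le) ?_)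
  · obtain ⟨δ, hδ, hb⟩ := Metric.mem_nhds_iff.1 (mem_interior_iff_mem_nhds.1 hw)
    exact hδ.trans_le (le_signedDist_of_ball z hδ i fun y hy => hb hy i)
  · rw [ofPred_forall]
    exact isOpen_iInter_of_finite fun i => isOpen_lt continuous_const (continuous_signedDist z i)

/-- A connected ball of radius `ε` about `w` cannot leave `Ω` without meeting the frontier.
Conversely, a frontier point has some `signedDist` at most zero, and the Lipschitz bound applies. -/
theorem mem_innerDomain_iff (hz : IsConvexPolygon z) {ε : ℝ} (hε : 0 < ε) {w : ℂ} :
    w ∈ innerDomain z ε ↔ ∀ i, ε ≤ signedDist z i w := by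
  have hopen : IsOpen (interiorDomain z) := isOpen_interior
  constructor
  · rintro ⟨hw, hd⟩ i
    refine le_signedDist_of_ball z hε i fun y hy => ?_
    have hsub : Metric.ball w ε ⊆ interiorDomain z := by
      refine (convex_ball w ε).isPreconnected.subset_of_closure_inter_subset hopen
        ⟨w, Metric.mem_ball_self hε, hw⟩ fun x hx => ?_
      by_contra hxn
      have hxf : x ∈ frontier (interiorDomain z) := by
        rw [hopen.frontier_eq]
        exact ⟨hx.1, hxn⟩
      have h1 := Metric.infDist_le_dist_of_mem (x := w) hxf
      have h2 := Metric.mem_ball'.1 hx.2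
      linarith
    have := hsub hy
    rw [hz.interiorDomain_eq] at this
    exact (this i).le
  · intro h
    have hw : w ∈ interiorDomain z := by
      rw [hz.interiorDomain_eq]
      exact fun i => hε.trans_le (h i)
    refine ⟨hw, ?_⟩
    have hne : (frontier (interiorDomain z)).Nonempty := by
      refine nonempty_frontier_iff.2 ⟨⟨w, hw⟩, fun huniv => ?_⟩
      have : z 0 ∈ interiorDomain z := huniv ▸ mem_univ _
      rw [hz.interiorDomain_eq] at this
      exact (this 0).ne' (signedDist_self z 0)
    rw [Metric.le_infDist hne]
    intro y hy
    rw [hopen.frontier_eq, hz.interiorDomain_eq] at hy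
    obtain ⟨i, hi⟩ := not_forall.1 hy.2
    linarith [signedDist_sub_le z i w y, h i]

theorem _root_.FokasPolygon.exists_eq_sidePoint (hz : IsConvexPolygon z) (i : Fin n) (w : ℂ) :
    ∃ x, w = sidePoint z i x (signedDist z i w) := by
  have hL : (sideLength z i : ℂ) ≠ 0 := by exact_mod_cast (hz.sideLength_pos i).ne'
  refine ⟨(sideDir z i * (w - z i)).re / sideLength z i, ?_⟩
  rw [sidePoint, signedDist, sub_eq_sideLength_mul]
  have h := Complex.re_add_im (sideDir z i * (w - z i))
  have h2 : w - z i = (sideDir z i * (w - z i)) * (starRingEnd ℂ) (sideDir z i) := by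
    rw [mul_right_comm, sideDir_mul_conj, one_mul]
  push_cast
  rw [← mul_assoc, div_mul_cancel₀ _ hL, ← mul_assoc, add_assoc, ← add_mul, h,
    ← sub_eq_iff_eq_add']
  exact h2

/-- The normalised abscissae of the points of the edge `Γ_i^ε`. -/
def _root_.FokasPolygon.innerAbscissae (z : Fin n → ℂ) (i : Fin n) (ε : ℝ) : Set ℝ :=
  {x | ∀ j, ε ≤ signedDist z j (sidePoint z i x ε)}

/-- The two neighbouring sides suffice: the previous one forces `0 ≤ x`, the next one `x ≤ 1`. -/
theorem mem_Icc_of_signedDist_nonneg (hz : IsConvexPolygon z) (i : Fin n) {x : ℝ}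
    (h : ∀ j, j ≠ i → 0 ≤ signedDist z j (sidePoint z i x 0)) : x ∈ Icc (0 : ℝ) 1 := by
  obtain ⟨k, hk⟩ : ∃ k, k + 1 = i := ⟨i - 1, sub_add_cancel _ _⟩
  have hki : k ≠ i := hk ▸ (cyclic_succ_ne hz.1 k).symm
  have h1 := h (i + 1) (cyclic_succ_ne hz.1 i)
  have h2 := h k hki
  rw [signedDist_sidePoint, signedDist_self, zero_mul, add_zero, mul_zero, add_zero] at h1
  have p1 : 0 < signedDist z (i + 1) (z i) := hz.signedDist_pos (cyclic_succ_ne hz.1 i).symm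
    (cyclic_succ_succ_ne hz.1 i).symm
  have p2 : 0 < signedDist z k (z (i + 1)) := by
    refine hz.signedDist_pos ?_ ?_
    · rw [← hk]; exact cyclic_succ_succ_ne hz.1 k
    · rw [hk]; exact cyclic_succ_ne hz.1 i
  rw [signedDist_sidePoint, show signedDist z k (z i) = 0 by rw [← hk, signedDist_succ], mul_zero,
    zero_add, zero_mul, add_zero] at h2
  exact ⟨nonneg_of_mul_nonneg_left h2 p2, by linarith [nonneg_of_mul_nonneg_left h1 p1]⟩

theorem innerAbscissae_subset (hz : IsConvexPolygon z) (i : Fin n) {ε : ℝ} (hε : 0 < ε) :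
    innerAbscissae z i ε ⊆ Icc 0 1 := by
  refine fun x hx => hz.mem_Icc_of_signedDist_nonneg i fun j _ => ?_
  have h1 := hx j
  have h2 := abs_le.1 (abs_sideCos_le z i j)
  rw [signedDist_sidePoint] at h1 ⊢
  nlinarith

/-- The height is at most the distance to the side, hence at most `ε`, and membership in `Ω_ε` makes
it at least `ε`. Conversely, the abscissa lies in `[0,1]`, so the foot of the perpendicular belongs
to the side. -/
theorem mem_innerEdge_iff (hz : IsConvexPolygon z) (i : Fin n) {ε : ℝ} (hε : 0 < ε) {w : ℂ} :
    w ∈ innerEdge z i ε ↔ ∃ x ∈ innerAbscissae z i ε, w = sidePoint z i x ε := by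
  have hseg : ∀ y ∈ segment ℝ (z i) (z (i + 1)), signedDist z i y = 0 := by
    intro y hy
    rw [segment_eq_image'] at hy
    obtain ⟨θ, -, rfl⟩ := hy
    have := signedDist_lineMap z i (z i) (z (i + 1)) 0 θ
    rw [signedDist_self, signedDist_succ, add_zero] at this
    simpa using this
  have hne : (segment ℝ (z i) (z (i + 1))).Nonempty := ⟨_, left_mem_segment ℝ _ _⟩
  constructor
  · rintro ⟨hw, hd⟩
    rw [hz.mem_innerDomain_iff hε] at hw
    have hcomp : IsCompact (segment ℝ (z i) (z (i + 1))) := by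
      rw [segment_eq_image']
      exact isCompact_Icc.image (by fun_prop)
    obtain ⟨y, hy, hyd⟩ := hcomp.exists_infDist_eq_dist hne w
    have h1 := signedDist_sub_le z i w y
    rw [hseg y hy, ← hyd, hd, sub_zero] at h1
    obtain ⟨x, hx⟩ := exists_eq_sidePoint hz i w
    rw [le_antisymm h1 (hw i)] at hx
    exact ⟨x, fun j => hx ▸ hw j, hx⟩
  · rintro ⟨x, hx, rfl⟩
    refine ⟨(hz.mem_innerDomain_iff hε).2 hx, le_antisymm ?_ ?_⟩
    · have hmem : sidePoint z i x 0 ∈ segment ℝ (z i) (z (i + 1)) := by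
        rw [segment_eq_image']
        exact ⟨x, hz.innerAbscissae_subset i hε hx, by simp [sidePoint]⟩
      refine (Metric.infDist_le_dist_of_mem hmem).trans_eq ?_
      rw [dist_eq_norm, sidePoint, sidePoint, Complex.ofReal_zero, zero_mul, add_zero,
        add_sub_cancel_left, norm_mul, norm_mul, Complex.norm_I, RCLike.norm_conj, norm_sideDir,
        Complex.norm_of_nonneg hε.le, mul_one, mul_one]
    · rw [Metric.le_infDist hne]
      intro y hy
      have h1 := signedDist_sub_le z i (sidePoint z i x ε) y
      rwa [hseg y hy, signedDist_sidePoint_self, sub_zero] at h1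

theorem eventually_Icc_subset_innerAbscissae (hz : IsConvexPolygon z) (i : Fin n) {δ : ℝ}
    (hδ : 0 < δ) : ∀ᶠ ε in 𝓝[>] (0 : ℝ), Icc δ (1 - δ) ⊆ innerAbscissae z i ε := by
  have h : ∀ j, ∀ᶠ ε in 𝓝[>] (0 : ℝ), ∀ x ∈ Icc δ (1 - δ),
      ε ≤ signedDist z j (sidePoint z i x ε) := by
    intro j
    by_cases hj : j = i
    · subst hj
      exact Eventually.of_forall fun ε x _ => by rw [signedDist_sidePoint_self]
    · set A := signedDist z j (z i) with hA
      set B := signedDist z j (z (i + 1)) with hB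
      have hA0 : 0 ≤ A := hz.signedDist_nonneg j i
      have hB0 : 0 ≤ B := hz.signedDist_nonneg j (i + 1)
      have hAB : 0 < A + B := by
        rcases hz.signedDist_add_pos hj with h | h <;> linarith
      -- At height zero the distance to line `j` is at least `δ(A + B)`, and rising to height `ε`
      -- costs at most `ε`; so `2ε ≤ δ(A + B)` is enough.
      filter_upwards [Ioo_mem_nhdsGT (show 0 < δ * (A + B) / 2 by positivity)] with ε hε x hx
      have h2 := abs_le.1 (abs_sideCos_le z i j)
      rw [signedDist_sidePoint]
      nlinarith [mul_le_mul_of_nonneg_right hx.1 hB0, hε.1, hε.2,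
        mul_le_mul_of_nonneg_right (show δ ≤ 1 - x by linarith [hx.2]) hA0]
  filter_upwards [eventually_all.2 h] with ε hε x hx j
  exact hε j x hx

theorem innerAbscissae_eq_Icc (hz : IsConvexPolygon z) (i : Fin n) {ε : ℝ} (hε : 0 < ε)
    (hne : (innerAbscissae z i ε).Nonempty) :
    innerAbscissae z i ε = Icc (sInf (innerAbscissae z i ε)) (sSup (innerAbscissae z i ε)) := by
  have hset : innerAbscissae z i ε = ⋂ j, {x | ε ≤ signedDist z j (sidePoint z i x ε)} := by
    ext x
    simp [innerAbscissae]
  have hconv : Convex ℝ (innerAbscissae z i ε) := by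
    rw [hset]
    refine convex_iInter fun j x hx y hy a b ha hb hab => ?_
    simp only [mem_ofPred_eq, signedDist_sidePoint, smul_eq_mul] at *
    obtain rfl : a = 1 - b := by linarith
    nlinarith [mul_le_mul_of_nonneg_left hx ha, mul_le_mul_of_nonneg_left hy hb]
  have hclosed : IsClosed (innerAbscissae z i ε) := by
    rw [hset]
    refine isClosed_iInter fun j => ?_
    simp only [signedDist_sidePoint]
    exact isClosed_le continuous_const (by fun_prop)
  exact eq_Icc_of_connected_compact ⟨hne, hconv.isPreconnected⟩
    (isCompact_Icc.of_isClosed_subset hclosed (hz.innerAbscissae_subset i hε))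

theorem _root_.FokasPolygon.affineParam_sidePoint (z : Fin n → ℂ) (i : Fin n) (x y t τ : ℝ) :
    affineParam (sidePoint z i x t) (sidePoint z i y t) τ =
      sidePoint z i ((1 - τ) * x + τ * y) t := by
  simp only [affineParam, sidePoint]
  push_cast
  ring

/-- The inner edges `Γ_i^ε` for small `ε`, in the coordinates along `Γ_i`. -/
theorem exists_innerEdge_abscissae (hz : IsConvexPolygon z) (i : Fin n) :
    ∃ xa xb : ℝ → ℝ, Tendsto xa (𝓝[>] 0) (𝓝 0) ∧ Tendsto xb (𝓝[>] 0) (𝓝 1) ∧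
      ∀ᶠ ε in 𝓝[>] (0 : ℝ), 0 < ε ∧ 0 ≤ xa ε ∧ xa ε < xb ε ∧ xb ε ≤ 1 ∧
        IsInnerEdgeEndpoints z i ε (sidePoint z i (xa ε) ε) (sidePoint z i (xb ε) ε) ∧
        ∀ x ∈ Icc (xa ε) (xb ε), ∀ j, ε ≤ signedDist z j (sidePoint z i x ε) := by
  have hpos : ∀ᶠ ε in 𝓝[>] (0 : ℝ), 0 < ε := self_mem_nhdsWithin
  have hbds : ∀ δ : ℝ, 0 < δ → δ < 1 / 2 → ∀ᶠ ε in 𝓝[>] (0 : ℝ),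
      innerAbscissae z i ε = Icc (sInf (innerAbscissae z i ε)) (sSup (innerAbscissae z i ε)) ∧
      0 ≤ sInf (innerAbscissae z i ε) ∧ sInf (innerAbscissae z i ε) ≤ δ ∧
      1 - δ ≤ sSup (innerAbscissae z i ε) ∧ sSup (innerAbscissae z i ε) ≤ 1 := by
    intro δ h0 h1
    filter_upwards [hz.eventually_Icc_subset_innerAbscissae i h0, hpos] with ε hsub hε
    have m1 : δ ∈ innerAbscissae z i ε := hsub ⟨le_rfl, by linarith⟩
    have m2 : 1 - δ ∈ innerAbscissae z i ε := hsub ⟨by linarith, le_rfl⟩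
    have heq := hz.innerAbscissae_eq_Icc i hε ⟨δ, m1⟩
    have hs := hz.innerAbscissae_subset i hε
    have b1 : BddBelow (innerAbscissae z i ε) := ⟨0, fun x hx => (hs hx).1⟩
    have b2 : BddAbove (innerAbscissae z i ε) := ⟨1, fun x hx => (hs hx).2⟩
    exact ⟨heq, le_csInf ⟨δ, m1⟩ fun x hx => (hs hx).1, csInf_le b1 m1, le_csSup b2 m2,
      csSup_le ⟨δ, m1⟩ fun x hx => (hs hx).2⟩
  refine ⟨fun ε => sInf (innerAbscissae z i ε), fun ε => sSup (innerAbscissae z i ε), ?_, ?_, ?_⟩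
  · refine tendsto_order.2 ⟨fun a ha => ?_, fun a ha => ?_⟩
    · filter_upwards [hbds (1 / 4) (by norm_num) (by norm_num)] with ε h
      linarith [h.2.1]
    · filter_upwards [hbds (min (a / 2) (1 / 4)) (by positivity)
        ((min_le_right _ _).trans_lt (by norm_num))] with ε h
      linarith [h.2.2.1, min_le_left (a / 2) (1 / 4)]
  · refine tendsto_order.2 ⟨fun a ha => ?_, fun a ha => ?_⟩
    · filter_upwards [hbds (min ((1 - a) / 2) (1 / 4)) (lt_min (by linarith) (by norm_num))
        ((min_le_right _ _).trans_lt (by norm_num))] with ε h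
      linarith [h.2.2.2.1, min_le_left ((1 - a) / 2) (1 / 4)]
    · filter_upwards [hbds (1 / 4) (by norm_num) (by norm_num)] with ε h
      linarith [h.2.2.2.2]
  · filter_upwards [hbds (1 / 4) (by norm_num) (by norm_num), hpos] with ε h hε
    obtain ⟨heq, h1, h2, h3, h4⟩ := h
    set xa := sInf (innerAbscissae z i ε)
    set xb := sSup (innerAbscissae z i ε)
    have hlt : xa < xb := by linarith
    have hmem : ∀ x ∈ Icc xa xb, x ∈ innerAbscissae z i ε := fun x hx => heq ▸ hx
    refine ⟨hε, h1, hlt, h4, ⟨?_, xb - xa, sub_pos.2 hlt, ?_⟩, hmem⟩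
    · ext w
      rw [hz.mem_innerEdge_iff i hε, segment_eq_image']
      constructor
      · rintro ⟨θ, hθ, rfl⟩
        refine ⟨(1 - θ) * xa + θ * xb, hmem _ ⟨?_, ?_⟩, ?_⟩
        · nlinarith [hθ.1, hθ.2]
        · nlinarith [hθ.1, hθ.2]
        · rw [← affineParam_sidePoint]
          simp only [affineParam, Complex.real_smul]
          ring
      · rintro ⟨x, hx, rfl⟩
        rw [heq] at hx
        have hne : xb - xa ≠ 0 := (sub_pos.2 hlt).ne'
        refine ⟨(x - xa) / (xb - xa), ⟨div_nonneg (by linarith [hx.1]) (by linarith),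
          div_le_one_of_le₀ (by linarith [hx.2]) (by linarith)⟩, ?_⟩
        have h5 : (1 - (x - xa) / (xb - xa)) * xa + (x - xa) / (xb - xa) * xb = x := by
          field_simp
          ring
        refine Eq.trans ?_ (congrArg (fun y => sidePoint z i y ε) h5)
        simp only []
        rw [← affineParam_sidePoint]
        simp only [affineParam, Complex.real_smul]
        ring
    · simp only [sidePoint]
      push_cast
      ring

end IsConvexPolygon

end FokasPolygon

end

noncomputable section

namespace FokasPolygon

open MeasureTheory

variable {n : ℕ} [NeZero n]

/-! ### The contributions of the other sides to the boundary values -/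

theorem im_sideDir_mul_sub (z : Fin n → ℂ) (i : Fin n) (w y : ℂ) :
    (sideDir z i * (w - y)).im = signedDist z i w - signedDist z i y := by
  rw [signedDist, signedDist, ← Complex.sub_im]
  congr 1
  ring

theorem continuous_sidePoint (z : Fin n → ℂ) (i : Fin n) :
    Continuous fun p : ℝ × ℝ => sidePoint z i p.1 p.2 := by
  unfold sidePoint
  fun_prop

theorem mem_decayDomain_sideDir {z : Fin n → ℂ} {j : Fin n} {w : ℂ} (h : 0 < signedDist z j w) :
    w ∈ decayDomain (z j) (z (j + 1)) (sideDir z j) := by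
  refine ⟨h, ?_⟩
  rw [im_sideDir_mul_sub, signedDist_succ, sub_zero]
  exact h

/-- Beyond the line of `Γ_i` every vertex is on the other side, so a single direction serves all
sides `j` at once. Only there can the global relation be integrated. -/
theorem IsConvexPolygon.mem_decayDomain_neg_sideDir {z : Fin n → ℂ} (hz : IsConvexPolygon z)
    (i j : Fin n) {w : ℂ} (h : signedDist z i w < 0) :
    w ∈ decayDomain (z j) (z (j + 1)) (-sideDir z i) := by
  have h0 : ∀ k, 0 < (-sideDir z i * (w - z k)).im := fun k => by
    rw [neg_mul, Complex.neg_im, im_sideDir_mul_sub]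
    linarith [hz.signedDist_nonneg i k]
  exact ⟨h0 j, h0 (j + 1)⟩

theorem S01.continuousOn (φ : S01) : ContinuousOn φ (Ioo 0 1) := φ.smooth.continuousOn

theorem S01.exists_inv_pow_mul_norm_le (φ : S01) (M : ℕ) : ∃ C : ℝ, ∀ τ ∈ Ioo (0 : ℝ) 1,
    ((τ * (1 - τ)) ^ M)⁻¹ * ‖φ τ‖ ≤ C := by
  obtain ⟨C, hC⟩ := φ.flat M 0
  refine ⟨C, fun τ hτ => ?_⟩
  have := hC τ hτ
  rwa [iteratedDeriv_zero, ← mul_inv, ← mul_pow] at this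

theorem S01.exists_norm_le (φ : S01) : ∃ C : ℝ, ∀ τ ∈ Ioo (0 : ℝ) 1, ‖φ τ‖ ≤ C := by
  obtain ⟨C, hC⟩ := φ.exists_inv_pow_mul_norm_le 0
  exact ⟨C, fun τ hτ => by simpa using hC τ hτ⟩

theorem S01.integrableOn_mul (φ : S01) {f : ℝ → ℂ} (hf : ContinuousOn f (Icc 0 1)) :
    IntegrableOn (fun τ => f τ * φ τ) (Ioo 0 1) := by
  obtain ⟨C, hC⟩ := φ.exists_norm_le
  obtain ⟨D, hD⟩ := isCompact_Icc.exists_bound_of_continuousOn hf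
  refine Integrable.mono' (g := fun _ => D * C) (integrableOn_const (by simp))
    (((hf.mono Ioo_subset_Icc_self).mul φ.continuousOn).aestronglyMeasurable measurableSet_Ioo) ?_
  filter_upwards [ae_restrict_mem measurableSet_Ioo] with τ hτ
  rw [norm_mul]
  have h1 := hD τ (Ioo_subset_Icc_self hτ)
  exact mul_le_mul h1 (hC τ hτ) (norm_nonneg _) ((norm_nonneg _).trans h1)

theorem integral_zero_one_eq (f : ℝ → ℂ) : ∫ τ in (0 : ℝ)..1, f τ = ∫ τ in Ioo (0 : ℝ) 1, f τ := by
  rw [intervalIntegral.integral_of_le zero_le_one, integral_Ioc_eq_integral_Ioo]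

/-- The difference between the integral over the ray `ℓ_j` at the point above the abscissa `x` of
`Γ_i` at height `t`, and the integral over the ray opposite to `ℓ_i` at the mirror image. -/
def rayJump (β : ℝ) (z : Fin n → ℂ) (i j : Fin n) (F : ℂ → ℂ) (x t : ℝ) : ℂ :=
  rayInt β F (sideDir z j) (sidePoint z i x t) - rayInt β F (-sideDir z i) (sidePoint z i x (-t))

theorem IsConvexPolygon.continuousOn_rayJump {β : ℝ} (hβ : β ≠ 0) {z : Fin n → ℂ}
    (hz : IsConvexPolygon z) (i j : Fin n) {F : ℂ → ℂ}
    (hF : IsSpectral β (z j) (z (j + 1)) F) {xa xb ε : ℝ} (hε : 0 < ε) (hab : xa ≤ xb)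
    (hpos : ∀ x ∈ Icc xa xb, 0 < signedDist z j (sidePoint z i x ε)) :
    ContinuousOn (fun τ => rayJump β z i j F ((1 - τ) * xa + τ * xb) ε) (Icc 0 1) := by
  have hc : ∀ t : ℝ, Continuous fun τ : ℝ => sidePoint z i ((1 - τ) * xa + τ * xb) t := fun t =>
    (continuous_sidePoint z i).comp (by fun_prop : Continuous fun τ : ℝ =>
      ((1 - τ) * xa + τ * xb, t))
  refine ContinuousOn.sub (fun τ hτ => ?_) (fun τ hτ => ?_)
  · have hx : (1 - τ) * xa + τ * xb ∈ Icc xa xb := ⟨by nlinarith [hτ.1, hτ.2],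
      by nlinarith [hτ.1, hτ.2]⟩
    exact (ContinuousAt.comp (f := fun τ : ℝ => sidePoint z i ((1 - τ) * xa + τ * xb) ε)
      (hF.continuousAt_rayInt hβ (mem_decayDomain_sideDir (hpos _ hx)))
      (hc ε).continuousAt).continuousWithinAt
  · refine (ContinuousAt.comp (f := fun τ : ℝ => sidePoint z i ((1 - τ) * xa + τ * xb) (-ε))
      (hF.continuousAt_rayInt hβ (hz.mem_decayDomain_neg_sideDir i j ?_))
      (hc (-ε)).continuousAt).continuousWithinAt
    rw [signedDist_sidePoint_self]
    linarith

/-- At the mirror image the direction `-sideDir z i` is barely decaying, but it can be turned to one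
that still decays on `Γ_i` itself. In the limit both rays decay at the same boundary point, so their
integrals agree there. -/
theorem IsConvexPolygon.tendsto_rayJump_offDiagonal {β : ℝ} (hβ : β ≠ 0) {z : Fin n → ℂ}
    (hz : IsConvexPolygon z) {i j : Fin n} (hij : j ≠ i) {F : ℂ → ℂ}
    (hF : IsSpectral β (z j) (z (j + 1)) F) {xa xb : ℝ → ℝ}
    (ha : Tendsto xa (𝓝[>] 0) (𝓝 0)) (hb : Tendsto xb (𝓝[>] 0) (𝓝 1))
    (hab : ∀ᶠ ε in 𝓝[>] (0 : ℝ), 0 < ε ∧ 0 ≤ xa ε ∧ xa ε < xb ε ∧ xb ε ≤ 1 ∧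
      ∀ x ∈ Icc (xa ε) (xb ε), ∀ j, ε ≤ signedDist z j (sidePoint z i x ε)) (φ : S01) :
    Tendsto (fun ε => ∫ τ in Ioo (0 : ℝ) 1,
      rayJump β z i j F ((1 - τ) * xa ε + τ * xb ε) ε * φ τ) (𝓝[>] 0) (𝓝 0) := by
  set A := signedDist z j (z i) with hA
  set B := signedDist z j (z (i + 1)) with hB
  have hA0 : 0 ≤ A := hz.signedDist_nonneg j i
  have hB0 : 0 ≤ B := hz.signedDist_nonneg j (i + 1)
  have hAB : 0 < A + B := by
    rcases hz.signedDist_add_pos hij with h | h <;> linarith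
  -- At depth `t` the part `-sideDir z i` contributes at least `t`, while descending changes the
  -- height above line `j` by at most `t`. So the decay rate along `s` is bounded below by that
  -- height at depth zero.
  set s := sideDir z j - sideDir z i with hs
  have him : ∀ (w : ℂ) (k : Fin n), (s * (w - z k)).im =
      (signedDist z j w - signedDist z j (z k)) - (signedDist z i w - signedDist z i (z k)) :=
    fun w k => by rw [hs, sub_mul, Complex.sub_im, im_sideDir_mul_sub, im_sideDir_mul_sub]
  have hmir : ∀ x t : ℝ, 0 ≤ t → ∀ k, signedDist z j (z k) = 0 →
      (1 - x) * A + x * B ≤ (s * (sidePoint z i x (-t) - z k)).im := by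
    intro x t ht k hk
    have h2 := abs_le.1 (abs_sideCos_le z i j)
    rw [him, signedDist_sidePoint_self, hk, signedDist_sidePoint]
    nlinarith [hz.signedDist_nonneg i k]
  have hmem : ∀ x t : ℝ, 0 ≤ t → 0 < (1 - x) * A + x * B →
      sidePoint z i x (-t) ∈ decayDomain (z j) (z (j + 1)) s := fun x t ht h =>
    ⟨h.trans_le (hmir x t ht j (signedDist_self z j)),
      h.trans_le (hmir x t ht (j + 1) (signedDist_succ z j))⟩
  have hpt : ∀ x ∈ Ioo (0 : ℝ) 1, 0 < (1 - x) * A + x * B := fun x hx => by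
    rcases hz.signedDist_add_pos hij with h | h <;> nlinarith [hx.1, hx.2]
  have hs0 : s ≠ 0 := ne_zero_of_mem_decayDomain
    (hmem (1 / 2) 0 le_rfl (hpt _ ⟨by norm_num, by norm_num⟩))
  have hj0 : sideDir z j ≠ 0 := Complex.exp_ne_zero _
  obtain ⟨C1, M1, hC1, b1⟩ := hF.exists_norm_rayInt_le hβ hj0
  obtain ⟨C2, M2, hC2, b2⟩ := hF.exists_norm_rayInt_le hβ hs0
  obtain ⟨D1, hD1⟩ := φ.exists_inv_pow_mul_norm_le M1
  obtain ⟨D2, hD2⟩ := φ.exists_inv_pow_mul_norm_le M2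
  -- For `ε` small, `x ≥ τ/2` and `1 - x ≥ (1 - τ)/2`, so the height `P` at level zero is at least
  -- `2κτ(1 - τ)`. At level `ε` the height is at least both `ε` and `P - ε`, hence at least `P/2`.
  set κ := (A + B) / 4 with hκ
  have hκ0 : 0 < κ := by positivity
  have hreg : ∀ᶠ ε in 𝓝[>] (0 : ℝ), xa ε < 1 / 2 ∧ 1 / 2 < xb ε :=
    ((tendsto_order.1 ha).2 _ (by norm_num)).and ((tendsto_order.1 hb).1 _ (by norm_num))
  have hlim : ∀ τ : ℝ, Tendsto (fun ε => (1 - τ) * xa ε + τ * xb ε) (𝓝[>] 0) (𝓝 τ) := fun τ => by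
    simpa using (ha.const_mul (1 - τ)).add (hb.const_mul τ)
  have hid : Tendsto (fun ε : ℝ => ε) (𝓝[>] 0) (𝓝 0) :=
    tendsto_nhdsWithin_of_tendsto_nhds tendsto_id
  rw [show (0 : ℂ) = ∫ τ in Ioo (0 : ℝ) 1, (0 : ℂ) by simp]
  refine tendsto_integral_filter_of_dominated_convergence
    (fun _ => C1 * (κ ^ M1)⁻¹ * D1 + C2 * (κ ^ M2)⁻¹ * D2) ?_ ?_ (by simp) ?_
  · filter_upwards [hab] with ε h
    exact (φ.integrableOn_mul (hz.continuousOn_rayJump hβ i j hF h.1 h.2.2.1.le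
      fun x hx => h.1.trans_le (h.2.2.2.2 x hx j))).aestronglyMeasurable
  · filter_upwards [hab, hreg] with ε ⟨hε, h1, h2, h3, h4⟩ ⟨h5, h6⟩
    filter_upwards [ae_restrict_mem measurableSet_Ioo] with τ hτ
    obtain ⟨t0, t1⟩ := hτ
    set x := (1 - τ) * xa ε + τ * xb ε with hx
    have hxm : x ∈ Icc (xa ε) (xb ε) := ⟨by nlinarith, by nlinarith⟩
    have x0 : τ / 2 ≤ x := by nlinarith
    have x1 : (1 - τ) / 2 ≤ 1 - x := by nlinarith
    have hm0 : 0 < τ * (1 - τ) := mul_pos t0 (by linarith)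
    have hm : 0 < κ * (τ * (1 - τ)) := by positivity
    have hp : 2 * (κ * (τ * (1 - τ))) ≤ (1 - x) * A + x * B := by
      have e1 : τ * (1 - τ) / 2 * A ≤ (1 - x) * A :=
        mul_le_mul_of_nonneg_right (by nlinarith) hA0
      have e2 : τ * (1 - τ) / 2 * B ≤ x * B :=
        mul_le_mul_of_nonneg_right (by nlinarith) hB0
      rw [hκ]
      linarith
    have hd : κ * (τ * (1 - τ)) ≤ signedDist z j (sidePoint z i x ε) := by
      have e1 := h4 x hxm j
      have e2 := abs_le.1 (abs_sideCos_le z i j)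
      rw [signedDist_sidePoint] at e1 ⊢
      nlinarith
    have n1 := b1 (sidePoint z i x ε) _ hm hd (by
      rwa [im_sideDir_mul_sub, signedDist_succ, sub_zero])
    have hp' : 0 < (1 - x) * A + x * B := by linarith
    have n2 := b2 (sidePoint z i x (-ε)) _ hm
      (le_trans (by linarith) (hmir x ε hε.le j (signedDist_self z j)))
      (le_trans (by linarith) (hmir x ε hε.le (j + 1) (signedDist_succ z j)))
    rw [← hF.rayInt_eq_rayInt hβ (hz.mem_decayDomain_neg_sideDir i j (by
      rw [signedDist_sidePoint_self]; linarith)) (hmem x ε hε.le hp')] at n2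
    rw [norm_mul]
    have n3 : ‖rayJump β z i j F x ε‖ ≤
        C1 * ((κ * (τ * (1 - τ))) ^ M1)⁻¹ + C2 * ((κ * (τ * (1 - τ))) ^ M2)⁻¹ :=
      (norm_sub_le _ _).trans (add_le_add n1 n2)
    refine (mul_le_mul_of_nonneg_right n3 (norm_nonneg _)).trans ?_
    have q1 := mul_le_mul_of_nonneg_left (hD1 τ ⟨t0, t1⟩)
      (show 0 ≤ C1 * (κ ^ M1)⁻¹ by positivity)
    have q2 := mul_le_mul_of_nonneg_left (hD2 τ ⟨t0, t1⟩)
      (show 0 ≤ C2 * (κ ^ M2)⁻¹ by positivity)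
    refine le_trans (le_of_eq ?_) (add_le_add q1 q2)
    rw [mul_pow κ _ M1, mul_pow κ _ M2, mul_inv (κ ^ M1), mul_inv (κ ^ M2)]
    ring
  · filter_upwards [ae_restrict_mem measurableSet_Ioo] with τ hτ
    have hp := hpt τ hτ
    have hm1 : sidePoint z i τ 0 ∈ decayDomain (z j) (z (j + 1)) (sideDir z j) := by
      refine mem_decayDomain_sideDir ?_
      rwa [signedDist_sidePoint, zero_mul, add_zero]
    have hm2 : sidePoint z i τ 0 ∈ decayDomain (z j) (z (j + 1)) s := by
      simpa using hmem τ 0 le_rfl hp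
    have hc := (continuous_sidePoint z i).tendsto (τ, 0)
    have l1 := (hF.continuousAt_rayInt hβ hm1).tendsto.comp (hc.comp ((hlim τ).prodMk_nhds hid))
    have hid' : Tendsto (fun ε : ℝ => -ε) (𝓝[>] 0) (𝓝 0) := by simpa using hid.neg
    have l2 := (hF.continuousAt_rayInt hβ hm2).tendsto.comp (hc.comp ((hlim τ).prodMk_nhds hid'))
    have l3 := l1.sub l2
    rw [hF.rayInt_eq_rayInt hβ hm1 hm2, sub_self] at l3
    rw [← zero_mul (φ τ)]
    refine Tendsto.mul_const _ (l3.congr' ?_)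
    have hpos : ∀ᶠ ε in 𝓝[>] (0 : ℝ),
        0 < (1 - ((1 - τ) * xa ε + τ * xb ε)) * A + ((1 - τ) * xa ε + τ * xb ε) * B :=
      (((tendsto_const_nhds.sub (hlim τ)).mul_const A).add
        ((hlim τ).mul_const B)).eventually (lt_mem_nhds hp)
    filter_upwards [hpos, hab] with ε h1 h2
    simp only [rayJump, Function.comp_apply]
    rw [hF.rayInt_eq_rayInt hβ (hz.mem_decayDomain_neg_sideDir i j (by
      rw [signedDist_sidePoint_self]; linarith)) (hmem _ ε h2.1.le h1)]

end FokasPolygon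

end

noncomputable section

namespace FokasPolygon

open MeasureTheory

variable {n : ℕ} [NeZero n]

/-! ### The contribution of the side itself -/

/-- The change of variables `r ↦ L (r - β²/r)` from the ray to the real line. -/
def spectralVar (β L r : ℝ) : ℝ := L * (r - β ^ 2 / r)

/-- The value of `r + β²/r` in terms of `y = L (r - β²/r)`, `r > 0`. -/
def spectralHeight (β L y : ℝ) : ℝ := √((y / L) ^ 2 + 4 * β ^ 2)

theorem spectralHeight_neg (β L y : ℝ) : spectralHeight β L (-y) = spectralHeight β L y := by
  simp [spectralHeight, neg_div]

theorem abs_div_le_spectralHeight (β L y : ℝ) : |y / L| ≤ spectralHeight β L y := by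
  rw [spectralHeight, ← Real.sqrt_sq_eq_abs]
  exact Real.sqrt_le_sqrt (by nlinarith [sq_nonneg β])

theorem spectralHeight_spectralVar {β L r : ℝ} (hL : 0 < L) (hr : 0 < r) :
    spectralHeight β L (spectralVar β L r) = r + β ^ 2 / r := by
  rw [spectralHeight, spectralVar, mul_div_cancel_left₀ _ hL.ne',
    show (r - β ^ 2 / r) ^ 2 + 4 * β ^ 2 = (r + β ^ 2 / r) ^ 2 by field_simp; ring]
  exact Real.sqrt_sq (by positivity)

theorem spectralVar_neg (β L r : ℝ) : spectralVar β L (-r) = -spectralVar β L r := by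
  simp only [spectralVar, div_neg]
  ring

theorem hasDerivAt_spectralVar (β L : ℝ) {r : ℝ} (hr : r ≠ 0) :
    HasDerivAt (spectralVar β L) (L * (1 + β ^ 2 / r ^ 2)) r := by
  have h := ((hasDerivAt_id r).sub ((hasDerivAt_inv hr).const_mul (β ^ 2))).const_mul L
  refine (h.congr_deriv ?_).congr_of_eventuallyEq (Eventually.of_forall fun x => ?_)
  · ring
  · simp [spectralVar, div_eq_mul_inv]

theorem injOn_spectralVar {L : ℝ} (β : ℝ) (hL : 0 < L) : InjOn (spectralVar β L) (Ioi 0) := by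
  intro r hr s hs h
  have hr : 0 < r := hr
  have hs : 0 < s := hs
  have h1 := mul_left_cancel₀ hL.ne' h
  have h2 : (r - s) * (r * s + β ^ 2) = 0 := by
    field_simp at h1
    nlinarith
  have h3 : r * s + β ^ 2 ≠ 0 := by positivity
  linarith [(mul_eq_zero.1 h2).resolve_right h3]

theorem image_spectralVar {β L : ℝ} (hβ : β ≠ 0) (hL : 0 < L) :
    spectralVar β L '' Ioi 0 = univ := by
  refine eq_univ_of_forall fun y => ?_
  set η := spectralHeight β L y with hη
  have h1 : |y / L| < η := by
    rw [hη, spectralHeight, ← Real.sqrt_sq_eq_abs]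
    exact Real.sqrt_lt_sqrt (sq_nonneg _) (by have := sq_pos_of_ne_zero hβ; linarith)
  have h2 : η ^ 2 = (y / L) ^ 2 + 4 * β ^ 2 := Real.sq_sqrt (by positivity)
  have h3 := abs_lt.1 h1
  -- The positive root of `r² - (y/L) r - β² = 0`.
  have h4 : 0 < (y / L + η) / 2 := by linarith
  refine ⟨(y / L + η) / 2, h4, ?_⟩
  have h5 : β ^ 2 / ((y / L + η) / 2) = (η - y / L) / 2 := by
    rw [div_eq_iff h4.ne']
    nlinarith
  rw [spectralVar, h5]
  field_simp
  ring

/-- The Jacobian is `L(r + β²/r)/r`, so `L dr/r` becomes `dy` divided by the spectral height. -/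
theorem integral_comp_spectralVar {β L : ℝ} (hβ : β ≠ 0) (hL : 0 < L) (f : ℝ → ℂ) :
    ∫ r in Ioi (0 : ℝ), (L * (1 + β ^ 2 / r ^ 2)) • f (spectralVar β L r) = ∫ y, f y := by
  have h := integral_image_eq_integral_abs_deriv_smul (measurableSet_Ioi (a := (0 : ℝ)))
    (fun r hr => (hasDerivAt_spectralVar β L (ne_of_gt hr)).hasDerivWithinAt)
    (injOn_spectralVar β hL) f
  rw [image_spectralVar hβ hL, Measure.restrict_univ] at h
  rw [h]
  refine integral_congr_ae (Eventually.of_forall fun r => ?_)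
  simp only
  rw [abs_of_nonneg (by positivity)]

theorem integrable_of_integrableOn_spectralVar {β L : ℝ} (hβ : β ≠ 0) (hL : 0 < L) {f : ℝ → ℂ}
    (h : IntegrableOn (fun r => (L * (1 + β ^ 2 / r ^ 2)) • f (spectralVar β L r)) (Ioi 0)) :
    Integrable f := by
  have h1 := integrableOn_image_iff_integrableOn_abs_deriv_smul (measurableSet_Ioi (a := (0 : ℝ)))
    (fun r hr => (hasDerivAt_spectralVar β L (ne_of_gt hr)).hasDerivWithinAt)
    (injOn_spectralVar β hL) f
  rw [image_spectralVar hβ hL, integrableOn_univ] at h1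
  refine h1.2 (h.congr (Eventually.of_forall fun r => ?_))
  simp only
  rw [abs_of_nonneg (by positivity)]

theorem conj_sideDir_eq_inv (z : Fin n → ℂ) (i : Fin n) :
    (starRingEnd ℂ) (sideDir z i) = (sideDir z i)⁻¹ :=
  eq_inv_of_mul_eq_one_right (sideDir_mul_conj z i)

/-- On the line of `ℓ_i` the phase splits into an oscillation in the abscissa and a damping in the
height. Negative `r` is allowed, to cover the opposite ray. -/
theorem rayKernel_sidePoint {β : ℝ} {z : Fin n → ℂ} {i : Fin n} {F : ℂ → ℂ} {r : ℝ} (hr : r ≠ 0)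
    {G : ℂ} (hF : F (r * sideDir z i) = kernel β (r * sideDir z i) (z i) * G) (x t : ℝ) :
    rayKernel β F (sidePoint z i x t) (r * sideDir z i) * sideDir z i =
      Complex.exp (Complex.I * x * spectralVar β (sideLength z i) r - t * (r + β ^ 2 / r)) *
        G / r := by
  have hu : sideDir z i ≠ 0 := Complex.exp_ne_zero _
  have hr' : (r : ℂ) ≠ 0 := by exact_mod_cast hr
  have hexp : Complex.exp (Complex.I * (r * sideDir z i) * sidePoint z i x t - Complex.I *
      (β : ℂ) ^ 2 * (starRingEnd ℂ) (sidePoint z i x t) / (r * sideDir z i)) *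
      kernel β (r * sideDir z i) (z i) =
      Complex.exp (Complex.I * x * spectralVar β (sideLength z i) r - t * (r + β ^ 2 / r)) := by
    rw [kernel, ← Complex.exp_add]
    congr 1
    rw [sidePoint, sub_eq_sideLength_mul]
    simp only [map_add, map_mul, Complex.conj_ofReal, Complex.conj_I, map_inv₀, inv_inv,
      conj_sideDir_eq_inv, spectralVar]
    push_cast
    field_simp
    ring_nf
    simp only [Complex.I_sq]
    ring
  rw [rayKernel, hF, ← hexp]
  field_simp

/-- Replacing `r` by `-r` reverses `y` and `r + β²/r`; mirroring reverses `t`, so the damping is the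
same on both rays. Over the whole `y`-line the integrands become `i(V/η + U)` and `i(V/η - U)` times
the same exponential, `η` being the spectral height, and subtraction removes `V`. -/
theorem IsConvexPolygon.rayJump_diagonal {β : ℝ} (hβ : β ≠ 0) {z : Fin n → ℂ}
    (hz : IsConvexPolygon z) (i : Fin n) {F : ℂ → ℂ} (hF : IsSpectral β (z i) (z (i + 1)) F)
    {U V : ℝ → ℂ}
    (hrep : ∀ r : ℝ, r ≠ 0 → F (r * sideDir z i) = kernel β (r * sideDir z i) (z i) *
      (Complex.I * sideLength z i * (V (spectralVar β (sideLength z i) r) +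
        (r + β ^ 2 / r) * U (spectralVar β (sideLength z i) r))))
    (x : ℝ) {t : ℝ} (ht : 0 < t) :
    rayJump β z i i F x t = 2 * Complex.I * ∫ y : ℝ,
      Complex.exp (Complex.I * x * y - t * spectralHeight β (sideLength z i) y) * U y := by
  have hL := hz.sideLength_pos i
  set L := sideLength z i with hLdef
  set f₁ : ℝ → ℂ := fun y => Complex.exp (Complex.I * x * y - t * spectralHeight β L y) *
    (Complex.I * (V y / spectralHeight β L y + U y)) with hf₁
  set f₂ : ℝ → ℂ := fun y => Complex.exp (Complex.I * x * y - t * spectralHeight β L y) *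
    (Complex.I * (V y / spectralHeight β L y - U y)) with hf₂
  have e₁ : ∀ r ∈ Ioi (0 : ℝ), rayFun β F (sideDir z i) (sidePoint z i x t) r =
      (L * (1 + β ^ 2 / r ^ 2)) • f₁ (spectralVar β L r) := by
    intro r hr
    have hr : 0 < r := hr
    have hr' : (r : ℂ) ≠ 0 := by exact_mod_cast hr.ne'
    have hν : (r + β ^ 2 / r : ℂ) ≠ 0 := by
      have : 0 < r + β ^ 2 / r := by positivity
      exact_mod_cast this.ne'
    rw [rayFun, rayKernel_sidePoint hr.ne' (hrep r hr.ne'), hf₁, ← hLdef]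
    simp only [spectralHeight_spectralVar hL hr, Complex.real_smul]
    push_cast
    generalize Complex.exp (Complex.I * x * spectralVar β L r - t * (r + β ^ 2 / r)) = E
    have hν' : (r ^ 2 + β ^ 2 : ℂ) ≠ 0 := by
      have : 0 < r ^ 2 + β ^ 2 := by positivity
      exact_mod_cast this.ne'
    rw [show V (spectralVar β L r) / (r + β ^ 2 / r : ℂ) + U (spectralVar β L r) =
      (V (spectralVar β L r) + (r + β ^ 2 / r) * U (spectralVar β L r)) / (r + β ^ 2 / r) by
        rw [add_div, mul_div_cancel_left₀ _ hν]]
    rw [show (r + β ^ 2 / r : ℂ) = (r ^ 2 + β ^ 2) / r by field_simp]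
    field_simp
  have e₂ : ∀ r ∈ Ioi (0 : ℝ), rayFun β F (-sideDir z i) (sidePoint z i x (-t)) r =
      (L * (1 + β ^ 2 / r ^ 2)) • (fun y => f₂ (-y)) (spectralVar β L r) := by
    intro r hr
    have hr : 0 < r := hr
    have hr' : (r : ℂ) ≠ 0 := by exact_mod_cast hr.ne'
    have hν : (r + β ^ 2 / r : ℂ) ≠ 0 := by
      have : 0 < r + β ^ 2 / r := by positivity
      exact_mod_cast this.ne'
    rw [rayFun, mul_neg, show (r * -sideDir z i : ℂ) = ((-r : ℝ) : ℂ) * sideDir z i by simp,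
      rayKernel_sidePoint (neg_ne_zero.2 hr.ne') (hrep (-r) (neg_ne_zero.2 hr.ne')), hf₂, ← hLdef]
    simp only [spectralHeight_neg, spectralHeight_spectralVar hL hr, Complex.real_smul,
      spectralVar_neg]
    push_cast
    have hν' : (r ^ 2 + β ^ 2 : ℂ) ≠ 0 := by
      have : 0 < r ^ 2 + β ^ 2 := by positivity
      exact_mod_cast this.ne'
    rw [show V (-spectralVar β L r) / (r + β ^ 2 / r : ℂ) - U (-spectralVar β L r) =
      (V (-spectralVar β L r) - (r + β ^ 2 / r) * U (-spectralVar β L r)) / (r + β ^ 2 / r) by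
        rw [sub_div, mul_div_cancel_left₀ _ hν]]
    rw [show (-t * (-r + β ^ 2 / -r) : ℂ) = t * (r + β ^ 2 / r) by rw [div_neg]; ring]
    generalize Complex.exp (Complex.I * x * -spectralVar β L r - t * (r + β ^ 2 / r)) = E
    rw [show (-r + β ^ 2 / -r : ℂ) = -((r ^ 2 + β ^ 2) / r) by rw [div_neg]; field_simp; ring,
      show (r + β ^ 2 / r : ℂ) = (r ^ 2 + β ^ 2) / r by field_simp]
    field_simp
    ring
  have m₁ : sidePoint z i x t ∈ decayDomain (z i) (z (i + 1)) (sideDir z i) :=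
    mem_decayDomain_sideDir (by rwa [signedDist_sidePoint_self])
  have m₂ : sidePoint z i x (-t) ∈ decayDomain (z i) (z (i + 1)) (-sideDir z i) :=
    hz.mem_decayDomain_neg_sideDir i i (by rw [signedDist_sidePoint_self]; linarith)
  have i₁ : Integrable f₁ := integrable_of_integrableOn_spectralVar hβ hL
    ((hF.integrableOn_rayFun hβ m₁).congr_fun e₁ measurableSet_Ioi)
  have i₂ : Integrable fun y => f₂ (-y) := integrable_of_integrableOn_spectralVar hβ hL
    ((hF.integrableOn_rayFun hβ m₂).congr_fun e₂ measurableSet_Ioi)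
  have i₂' : Integrable f₂ := by simpa using i₂.comp_neg
  rw [rayJump, rayInt, rayInt, setIntegral_congr_fun measurableSet_Ioi e₁,
    setIntegral_congr_fun measurableSet_Ioi e₂, integral_comp_spectralVar hβ hL,
    integral_comp_spectralVar hβ hL (fun y => f₂ (-y)), integral_neg_eq_self f₂ volume,
    ← integral_sub i₁ i₂',
    ← integral_const_mul]
  refine integral_congr_ae (Eventually.of_forall fun y => ?_)
  simp only [hf₁, hf₂]
  ring

end FokasPolygon

end

/-! ### Fourier inversion along a side -/

noncomputable section

namespace FokasPolygon

open MeasureTheory FourierTransform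

/-- The extension by zero of an element of `𝓢(0,1)`, as a Schwartz function. -/
def S01.toSchwartz (φ : S01) : SchwartzMap ℝ ℂ :=
  (HasCompactSupport.intro (isCompact_Icc (a := (0 : ℝ)) (b := 1)) fun _ hx =>
    indicator_of_notMem (fun h => hx (Ioo_subset_Icc_self h)) _ :
    HasCompactSupport ((Ioo (0 : ℝ) 1).indicator φ)).toSchwartzMap φ.contDiff_extend

theorem S01.integral_exp_mul (φ : S01) (a b y : ℝ) :
    ∫ τ in Ioo (0 : ℝ) 1, Complex.exp (Complex.I * ((1 - τ) * a + τ * b : ℝ) * y) * φ τ =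
      Complex.exp (Complex.I * a * y) * 𝓕 φ.toSchwartz (-((b - a) * y / (2 * Real.pi))) := by
  rw [SchwartzMap.fourier_coe, Real.fourier_eq', ← integral_const_mul,
    ← integral_indicator measurableSet_Ioo]
  refine integral_congr_ae (Eventually.of_forall fun τ => ?_)
  change _ = _ * (_ • (Ioo (0 : ℝ) 1).indicator φ τ)
  by_cases hτ : τ ∈ Ioo (0 : ℝ) 1
  · simp only [indicator_of_mem hτ]
    rw [smul_eq_mul, ← mul_assoc, ← Complex.exp_add]
    congr 2
    have hpi : (Real.pi : ℂ) ≠ 0 := by exact_mod_cast Real.pi_ne_zero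
    simp
    field_simp
    ring
  · simp only [indicator_of_notMem hτ]
    simp

theorem S01.exists_norm_fourier_le (φ : S01) (K : ℕ) :
    ∃ D : ℝ, 0 ≤ D ∧ ∀ x : ℝ, (1 + |x|) ^ K * ‖𝓕 φ.toSchwartz x‖ ≤ D := by
  refine ⟨2 ^ K * (Finset.Iic (K, 0)).sup (fun m => SchwartzMap.seminorm ℝ m.1 m.2)
    (𝓕 φ.toSchwartz), by positivity, fun x => ?_⟩
  have h := SchwartzMap.one_add_le_sup_seminorm_apply (𝕜 := ℝ) (m := (K, 0)) le_rfl le_rfl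
    (𝓕 φ.toSchwartz) x
  rwa [norm_iteratedFDeriv_zero, Real.norm_eq_abs] at h

theorem inv_one_add_abs_sq_le (y : ℝ) : ((1 + |y|) ^ 2)⁻¹ ≤ (1 + y ^ 2)⁻¹ := by
  apply inv_anti₀ (by positivity)
  nlinarith [abs_nonneg y, sq_abs y]

theorem integrable_exp_neg_spectralHeight_mul {β L t : ℝ} (hL : 0 < L) (ht : 0 < t) {U : ℝ → ℂ}
    (hU : Continuous U) {C : ℝ} {N : ℕ} (hC : 0 ≤ C) (hb : ∀ y, ‖U y‖ ≤ C * (1 + |y|) ^ N) :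
    Integrable fun y : ℝ => Complex.exp (-(t * spectralHeight β L y)) * U y := by
  have hc : 0 < t / L := by positivity
  set c := t / L with hcdef
  refine Integrable.mono' (g := fun y : ℝ =>
    Real.exp c * C * ((N + 2).factorial / c ^ (N + 2)) * (1 + y ^ 2)⁻¹)
    (integrable_inv_one_add_sq.const_mul _) ?_ (Eventually.of_forall fun y => ?_)
  · refine Continuous.aestronglyMeasurable (Continuous.mul ?_ hU)
    unfold spectralHeight
    fun_prop
  have h1 : ‖Complex.exp (-(t * spectralHeight β L y))‖ ≤
      Real.exp c * Real.exp (-(c * (1 + |y|))) := by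
    rw [← Complex.ofReal_mul, ← Complex.ofReal_neg, Complex.norm_exp_ofReal, ← Real.exp_add,
      Real.exp_le_exp]
    have h2 := mul_le_mul_of_nonneg_left (abs_div_le_spectralHeight β L y) ht.le
    rw [abs_div, abs_of_pos hL] at h2
    have h3 : c * |y| = t * (|y| / L) := by rw [hcdef]; ring
    linarith
  have h4 := Real.pow_div_factorial_le_exp (c * (1 + |y|)) (by positivity) (N + 2)
  have hx : 0 < 1 + |y| := by positivity
  rw [norm_mul]
  calc _ ≤ Real.exp c * Real.exp (-(c * (1 + |y|))) * (C * (1 + |y|) ^ N) := by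
        gcongr
        exact hb y
    _ = Real.exp c * (Real.exp (c * (1 + |y|)))⁻¹ * (C * (1 + |y|) ^ N) := by rw [Real.exp_neg]
    _ ≤ Real.exp c * ((c * (1 + |y|)) ^ (N + 2) / (N + 2).factorial)⁻¹ * (C * (1 + |y|) ^ N) := by
        gcongr
    _ = Real.exp c * C * ((N + 2).factorial / c ^ (N + 2)) * ((1 + |y|) ^ 2)⁻¹ := by
        rw [mul_pow]
        field_simp
        ring
    _ ≤ _ := by
        gcongr ?_ * ?_
        exact inv_one_add_abs_sq_le y

/-- Damping with `t > 0` justifies Fubini. Afterwards the decay in `y` comes from the transform of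
`φ`, so `t` may tend to zero. -/
theorem S01.integral_integral_exp_mul (φ : S01) {β L t : ℝ} (hL : 0 < L) (ht : 0 < t) {U : ℝ → ℂ}
    (hU : Continuous U) {C : ℝ} {N : ℕ} (hC : 0 ≤ C) (hb : ∀ y, ‖U y‖ ≤ C * (1 + |y|) ^ N)
    (a b : ℝ) :
    ∫ τ in Ioo (0 : ℝ) 1, (∫ y : ℝ, Complex.exp (Complex.I * ((1 - τ) * a + τ * b : ℝ) * y -
      t * spectralHeight β L y) * U y) * φ τ =
    ∫ y : ℝ, Complex.exp (-(t * spectralHeight β L y)) * U y *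
      (Complex.exp (Complex.I * a * y) * 𝓕 φ.toSchwartz (-((b - a) * y / (2 * Real.pi)))) := by
  have hφ : IntegrableOn φ (Ioo 0 1) := by
    simpa using φ.integrableOn_mul (f := fun _ => 1) continuousOn_const
  have hint := hφ.mul_prod (integrable_exp_neg_spectralHeight_mul (β := β) hL ht hU hC hb)
  have hf : Integrable (Function.uncurry fun τ y : ℝ =>
      Complex.exp (Complex.I * ((1 - τ) * a + τ * b : ℝ) * y) *
        (φ τ * (Complex.exp (-(t * spectralHeight β L y)) * U y)))
      ((volume.restrict (Ioo 0 1)).prod volume) := by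
    refine hint.bdd_mul (c := 1) ?_ (Eventually.of_forall fun p => ?_)
    · exact Continuous.aestronglyMeasurable (by fun_prop)
    · rw [mul_assoc, ← Complex.ofReal_mul, mul_comm, Complex.norm_exp_ofReal_mul_I]
  have hswap := integral_integral_swap hf
  calc _ = ∫ τ in Ioo (0 : ℝ) 1, ∫ y : ℝ, Complex.exp (Complex.I * ((1 - τ) * a + τ * b : ℝ) * y) *
        (φ τ * (Complex.exp (-(t * spectralHeight β L y)) * U y)) := by
        refine integral_congr_ae (Eventually.of_forall fun τ => ?_)
        simp only
        rw [← integral_mul_const]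
        refine integral_congr_ae (Eventually.of_forall fun y => ?_)
        simp only
        rw [sub_eq_add_neg, Complex.exp_add]
        ring
    _ = _ := by
        rw [hswap]
        refine integral_congr_ae (Eventually.of_forall fun y => ?_)
        simp only
        rw [← S01.integral_exp_mul, ← integral_const_mul]
        refine integral_congr_ae (Eventually.of_forall fun τ => ?_)
        simp only
        ring

/-- The Fourier-type integral produced by the side `Γ_i` recovers the datum in the limit. -/
theorem E01Dual.tendsto_integral_exp (u : E01Dual) (φ : S01) {β L : ℝ} (hL : 0 < L)
    {xa xb : ℝ → ℝ} (ha : Tendsto xa (𝓝[>] 0) (𝓝 0)) (hb : Tendsto xb (𝓝[>] 0) (𝓝 1)) :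
    Tendsto (fun t : ℝ => ∫ τ in Ioo (0 : ℝ) 1,
      (2 * Complex.I * ∫ y : ℝ, Complex.exp (Complex.I * ((1 - τ) * xa t + τ * xb t : ℝ) * y -
        t * spectralHeight β L y) * u (E01.exp (-Complex.I * y))) * φ τ)
      (𝓝[>] 0) (𝓝 (4 * Real.pi * Complex.I * u φ.toE01)) := by
  obtain ⟨C, N, hC, hbd⟩ := u.exists_norm_exp_le
  set U : ℝ → ℂ := fun y => u (E01.exp (-Complex.I * y)) with hU
  have hUc : Continuous U := u.differentiable_exp.continuous.comp (by fun_prop)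
  have hUb : ∀ y, ‖U y‖ ≤ C * (1 + |y|) ^ N := fun y => by
    have h1 : ‖-Complex.I * (y : ℂ)‖ = |y| := by simp
    have h2 : max (-Complex.I * (y : ℂ)).re 0 = 0 := by simp
    have h3 := hbd (-Complex.I * y)
    rwa [h1, h2, Real.exp_zero, mul_one] at h3
  -- `N` powers pay for the growth of `U`, two more for integrability.
  obtain ⟨D, hD0, hD⟩ := φ.exists_norm_fourier_le (N + 2)
  have hreg : ∀ᶠ t in 𝓝[>] (0 : ℝ), xa t < 1 / 4 ∧ 3 / 4 < xb t :=
    ((tendsto_order.1 ha).2 _ (by norm_num)).and ((tendsto_order.1 hb).1 _ (by norm_num))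
  have hpos : ∀ᶠ t in 𝓝[>] (0 : ℝ), 0 < t := self_mem_nhdsWithin
  have hid : Tendsto (fun t : ℝ => (t : ℂ)) (𝓝[>] 0) (𝓝 0) := by
    have : Tendsto (fun t : ℝ => (t : ℂ)) (𝓝 0) (𝓝 ((0 : ℝ) : ℂ)) :=
      Complex.continuous_ofReal.tendsto 0
    exact tendsto_nhdsWithin_of_tendsto_nhds (by simpa using this)
  have hFc : Continuous (𝓕 φ.toSchwartz : SchwartzMap ℝ ℂ) := SchwartzMap.continuous _
  have hpi := Real.pi_pos
  have hlim : Tendsto (fun t : ℝ => ∫ y : ℝ, Complex.exp (-(t * spectralHeight β L y)) * U y *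
      (Complex.exp (Complex.I * xa t * y) *
        𝓕 φ.toSchwartz (-((xb t - xa t) * y / (2 * Real.pi))))) (𝓝[>] 0)
      (𝓝 (∫ y : ℝ, U y * 𝓕 φ.toSchwartz (-(y / (2 * Real.pi))))) := by
    refine tendsto_integral_filter_of_dominated_convergence
      (fun y => C * D * (4 * Real.pi) ^ (N + 2) * (1 + y ^ 2)⁻¹) ?_ ?_
      (integrable_inv_one_add_sq.const_mul _) ?_
    · refine Eventually.of_forall fun t => Continuous.aestronglyMeasurable ?_
      refine Continuous.mul (Continuous.mul ?_ hUc) (Continuous.mul (by fun_prop)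
        (hFc.comp (by fun_prop)))
      unfold spectralHeight
      fun_prop
    · filter_upwards [hreg, hpos] with t ⟨h1, h2⟩ h0
      refine Eventually.of_forall fun y => ?_
      set ξ := -((xb t - xa t) * y / (2 * Real.pi)) with hξ
      have e1 : ‖Complex.exp (-(t * spectralHeight β L y))‖ ≤ 1 := by
        rw [← Complex.ofReal_mul, ← Complex.ofReal_neg, Complex.norm_exp_ofReal,
          Real.exp_le_one_iff]
        have := mul_nonneg h0.le ((abs_nonneg _).trans (abs_div_le_spectralHeight β L y))
        linarith
      have e2 : ‖Complex.exp (Complex.I * xa t * y)‖ = 1 := by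
        rw [mul_assoc, ← Complex.ofReal_mul, mul_comm, Complex.norm_exp_ofReal_mul_I]
      -- Uses `xb t - xa t > 1/2`, hence `|y| ≤ 4π|ξ|`.
      have e3 : 1 + |y| ≤ 4 * Real.pi * (1 + |ξ|) := by
        have : |ξ| = (xb t - xa t) * |y| / (2 * Real.pi) := by
          rw [hξ, abs_neg, abs_div, abs_mul, abs_of_pos (show 0 < xb t - xa t by linarith),
            abs_of_pos (show 0 < 2 * Real.pi by positivity)]
        have h3 : 4 * Real.pi * |ξ| = 2 * (xb t - xa t) * |y| := by
          rw [this]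
          field_simp
          ring
        nlinarith [abs_nonneg y, Real.pi_gt_three]
      have hy : 0 < 1 + |y| := by positivity
      have e4 : (1 + |y|) ^ (N + 2) * ‖𝓕 φ.toSchwartz ξ‖ ≤ (4 * Real.pi) ^ (N + 2) * D := by
        calc _ ≤ (4 * Real.pi * (1 + |ξ|)) ^ (N + 2) * ‖𝓕 φ.toSchwartz ξ‖ := by gcongr
          _ = (4 * Real.pi) ^ (N + 2) * ((1 + |ξ|) ^ (N + 2) * ‖𝓕 φ.toSchwartz ξ‖) := by
            rw [mul_pow]; ring
          _ ≤ _ := by gcongr; exact hD ξ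
      rw [norm_mul, norm_mul, norm_mul, e2, one_mul]
      calc _ ≤ 1 * (C * (1 + |y|) ^ N) * ‖𝓕 φ.toSchwartz ξ‖ := by
            gcongr
            exact hUb y
        _ = C * ((1 + |y|) ^ (N + 2) * ‖𝓕 φ.toSchwartz ξ‖) * ((1 + |y|) ^ 2)⁻¹ := by
            field_simp
            ring
        _ ≤ C * ((4 * Real.pi) ^ (N + 2) * D) * (1 + y ^ 2)⁻¹ := by
            gcongr ?_ * ?_
            · exact mul_le_mul_of_nonneg_left e4 hC
            · exact inv_one_add_abs_sq_le y
        _ = _ := by ring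
    · refine Eventually.of_forall fun y => ?_
      have l1 : Tendsto (fun t : ℝ => Complex.exp (-(t * spectralHeight β L y))) (𝓝[>] 0)
          (𝓝 1) := by
        have := ((hid.mul_const (spectralHeight β L y : ℂ)).neg).cexp
        simpa using this
      have l2 : Tendsto (fun t : ℝ => Complex.exp (Complex.I * xa t * y)) (𝓝[>] 0) (𝓝 1) := by
        have h1 : Tendsto (fun t => (xa t : ℂ)) (𝓝[>] 0) (𝓝 ((0 : ℝ) : ℂ)) :=
          (Complex.continuous_ofReal.tendsto 0).comp ha
        have := ((h1.const_mul Complex.I).mul_const (y : ℂ)).cexp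
        simpa using this
      have l3 : Tendsto (fun t : ℝ => 𝓕 φ.toSchwartz (-((xb t - xa t) * y / (2 * Real.pi))))
          (𝓝[>] 0) (𝓝 (𝓕 φ.toSchwartz (-(y / (2 * Real.pi))))) := by
        have h1 := (((hb.sub ha).mul_const y).div_const (2 * Real.pi)).neg
        rw [sub_zero, one_mul] at h1
        exact (hFc.tendsto _).comp h1
      simpa using (l1.mul_const (U y)).mul (l2.mul l3)
  have hval : ∫ y : ℝ, U y * 𝓕 φ.toSchwartz (-(y / (2 * Real.pi))) = 2 * Real.pi * u φ.toE01 := by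
    have h1 := u.integral_fourier_mul_exp φ.contDiff_extend
      (HasCompactSupport.intro (isCompact_Icc (a := (0 : ℝ)) (b := 1)) fun _ hx =>
        indicator_of_notMem (fun h => hx (Ioo_subset_Icc_self h)) _)
    have h2 := Measure.integral_comp_mul_left
      (fun y : ℝ => U y * 𝓕 φ.toSchwartz (-(y / (2 * Real.pi)))) (-(2 * Real.pi))
    have h3 : |(-(2 * Real.pi))⁻¹| = (2 * Real.pi)⁻¹ := by
      rw [abs_inv, abs_neg, abs_of_pos (by positivity)]
    rw [h3] at h2
    have h4 : ∫ x : ℝ, U (-(2 * Real.pi) * x) *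
        𝓕 φ.toSchwartz (-(-(2 * Real.pi) * x / (2 * Real.pi))) = u φ.toE01 := by
      refine Eq.trans (integral_congr_ae (Eventually.of_forall fun x => ?_)) h1
      simp only [hU]
      rw [show -(-(2 * Real.pi) * x / (2 * Real.pi)) = x by field_simp, mul_comm]
      congr 3
      push_cast
      ring
    rw [← h4, h2, Complex.real_smul]
    push_cast
    have : (Real.pi : ℂ) ≠ 0 := by exact_mod_cast Real.pi_ne_zero
    field_simp
  have hfin := hlim.const_mul (2 * Complex.I)
  rw [hval, show 2 * Complex.I * (2 * Real.pi * u φ.toE01) =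
    4 * Real.pi * Complex.I * u φ.toE01 by ring] at hfin
  refine hfin.congr' ?_
  filter_upwards [hpos] with t ht
  rw [← φ.integral_integral_exp_mul hL ht hUc hC hUb, ← integral_const_mul]
  refine integral_congr_ae (Eventually.of_forall fun τ => ?_)
  simp only
  ring

end FokasPolygon

end

noncomputable section

namespace FokasPolygon

open MeasureTheory

variable {n : ℕ} [NeZero n]

/-! ### Spectral functions -/

theorem norm_kernel (β : ℝ) {l : ℂ} (hl : l ≠ 0) (w : ℂ) :
    ‖kernel β l w‖ = Real.exp ((1 + β ^ 2 / ‖l‖ ^ 2) * (l * w).im) := by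
  have h := norm_exp_phase β (-w) hl
  rw [show -((1 + β ^ 2 / ‖l‖ ^ 2) * (l * -w).im) = (1 + β ^ 2 / ‖l‖ ^ 2) * (l * w).im by
    rw [mul_neg l, Complex.neg_im]; ring] at h
  rw [← h, kernel]
  congr 2
  rw [map_neg]
  ring

/-- The exponent of `ψ_i^*(e^{-iλz + iβ²z̄/λ})`, up to an additive constant. -/
def sideExponent (β : ℝ) (z : Fin n → ℂ) (i : Fin n) (l : ℂ) : ℂ :=
  -Complex.I * l * (z (i + 1) - z i) +
    Complex.I * (β : ℂ) ^ 2 * (starRingEnd ℂ) (z (i + 1) - z i) / l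

theorem kernelPullback_eq (β : ℝ) (z : Fin n → ℂ) (i : Fin n) (l : ℂ) :
    kernelPullback β z i l = kernel β l (z i) • E01.exp (sideExponent β z i l) := by
  refine Subtype.ext (funext fun τ => ?_)
  change kernel β l (sideParam z i τ) = kernel β l (z i) * Complex.exp (sideExponent β z i l * τ)
  rw [kernel, kernel, ← Complex.exp_add]
  congr 1
  simp only [sideParam, affineParam, sideExponent, map_add, map_mul, map_sub, map_one,
    Complex.conj_ofReal]
  ring

theorem re_sideExponent (β : ℝ) (z : Fin n → ℂ) (i : Fin n) {l : ℂ} (hl : l ≠ 0) :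
    (sideExponent β z i l).re =
      (1 + β ^ 2 / ‖l‖ ^ 2) * ((l * z (i + 1)).im - (l * z i).im) := by
  have h := norm_kernel β hl (z (i + 1) - z i)
  rw [kernel, Complex.norm_exp, Real.exp_eq_exp] at h
  rw [← Complex.sub_im, ← mul_sub]
  exact h

theorem one_le_norm_add_inv {l : ℂ} (hl : l ≠ 0) : 1 ≤ ‖l‖ + ‖l‖⁻¹ := by
  have h0 : 0 < ‖l‖ := norm_pos_iff.2 hl
  have h1 : ‖l‖ * ‖l‖⁻¹ = 1 := mul_inv_cancel₀ h0.ne'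
  nlinarith [inv_pos.2 h0, sq_nonneg (‖l‖ - ‖l‖⁻¹)]

/-- The kernel along the side is its value at `z_i` times `e^{Aτ}`, and `Re A` is the difference of
the log-moduli at the two ends. So `max (Re A) 0` turns the first endpoint into the larger of the
two. -/
theorem isSpectral_kernelPullback (β : ℝ) (z : Fin n → ℂ) (i : Fin n) (u : E01Dual) :
    IsSpectral β (z i) (z (i + 1)) fun l => u (kernelPullback β z i l) := by
  have h0 : ∀ l ∈ ({0}ᶜ : Set ℂ), l ≠ 0 := fun l hl => hl
  have hinv : ∀ (a b : ℂ), DifferentiableOn ℂ (fun l => -Complex.I * l * a + b / l) {0}ᶜ :=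
    fun a b => ((differentiableOn_id.const_mul _).mul_const _).add
      (DifferentiableOn.div (differentiableOn_const _) differentiableOn_id h0)
  obtain ⟨C, N, hC, hb⟩ := u.exists_norm_exp_le
  have heq : ∀ l, u (kernelPullback β z i l) =
      kernel β l (z i) * u (E01.exp (sideExponent β z i l)) := fun l => by
    rw [kernelPullback_eq, map_smul, smul_eq_mul]
  simp only [heq]
  refine ⟨DifferentiableOn.mul (hinv _ _).cexp
    (u.differentiable_exp.comp_differentiableOn (hinv _ _)),
    C * (1 + ‖z (i + 1) - z i‖ * (1 + β ^ 2)) ^ N, N, by positivity, fun l hl => ?_⟩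
  have hl0 : 0 < ‖l‖ := norm_pos_iff.2 hl
  have hlinv : 0 < ‖l‖⁻¹ := inv_pos.2 hl0
  have hc : 1 + ‖sideExponent β z i l‖ ≤
      (1 + ‖z (i + 1) - z i‖ * (1 + β ^ 2)) * (‖l‖ + ‖l‖⁻¹) := by
    have e1 : ‖sideExponent β z i l‖ ≤
        ‖l‖ * ‖z (i + 1) - z i‖ + β ^ 2 * ‖z (i + 1) - z i‖ * ‖l‖⁻¹ := by
      refine (norm_add_le _ _).trans_eq ?_
      rw [norm_div, norm_mul (Complex.I * _), RCLike.norm_conj]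
      simp [div_eq_mul_inv]
    have e2 := one_le_norm_add_inv hl
    nlinarith [mul_nonneg (norm_nonneg (z (i + 1) - z i)) hlinv.le,
      mul_nonneg (mul_nonneg (sq_nonneg β) (norm_nonneg (z (i + 1) - z i))) hl0.le]
  have hmax : (1 + β ^ 2 / ‖l‖ ^ 2) * (l * z i).im + max (sideExponent β z i l).re 0 =
      (1 + β ^ 2 / ‖l‖ ^ 2) * max (l * z i).im (l * z (i + 1)).im := by
    rw [re_sideExponent β z i hl, ← max_add_add_left, mul_max_of_nonneg _ _ (by positivity),
      max_comm]
    congr 1 <;> ring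
  rw [norm_mul, norm_kernel β hl, ← hmax, Real.exp_add]
  calc _ ≤ Real.exp ((1 + β ^ 2 / ‖l‖ ^ 2) * (l * z i).im) *
        (C * ((1 + ‖z (i + 1) - z i‖ * (1 + β ^ 2)) * (‖l‖ + ‖l‖⁻¹)) ^ N *
          Real.exp (max (sideExponent β z i l).re 0)) := by
        refine mul_le_mul_of_nonneg_left ((hb _).trans ?_) (Real.exp_pos _).le
        gcongr
    _ = _ := by rw [mul_pow]; ring

/-- The coefficient of `q_i` in `ρ_i` is the symbol of the normal derivative, which is why
differentiating `Q` along the normal interchanges the roles of the data. -/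
theorem dirFactor_outwardNormal (β : ℝ) (z : Fin n → ℂ) (i : Fin n) (l : ℂ) :
    dirFactor β (outwardNormal z i) l = l * Complex.exp (Complex.I * sideAngle z i) +
      (β : ℂ) ^ 2 / (l * Complex.exp (Complex.I * sideAngle z i)) := by
  rw [dirFactor, outwardNormal, ← conj_sideDir, map_mul, map_neg, Complex.conj_I, Complex.conj_conj,
    conj_sideDir_eq_inv]
  have h1 : Complex.I * l * (-Complex.I * (sideDir z i)⁻¹) = l * (sideDir z i)⁻¹ := by
    linear_combination (-(l * (sideDir z i)⁻¹)) * Complex.I_mul_I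
  have h2 : Complex.I * (β : ℂ) ^ 2 * (- -Complex.I * sideDir z i) / l =
      -((β : ℂ) ^ 2 / (l * (sideDir z i)⁻¹)) := by
    rw [div_eq_mul_inv, div_eq_mul_inv, mul_inv, inv_inv]
    linear_combination ((β : ℂ) ^ 2 * sideDir z i * l⁻¹) * Complex.I_mul_I
  rw [h1, h2, sub_neg_eq_add]

theorem isSpectral_rho (β : ℝ) (z : Fin n → ℂ) (q dq : Fin n → E01Dual) (i : Fin n) :
    IsSpectral β (z i) (z (i + 1)) (rho β z q dq i) := by
  have h := ((isSpectral_kernelPullback β z i (dq i)).add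
    ((isSpectral_kernelPullback β z i (q i)).dirFactor_mul (outwardNormal z i))).const_mul
    (Complex.I * sideLength z i)
  convert h using 2 with l
  rw [rho, dirFactor_outwardNormal]

theorem repQ_eq (β : ℝ) (z : Fin n → ℂ) (q dq : Fin n → E01Dual) :
    repQ β z q dq = fun w => 1 / (4 * Real.pi * Complex.I) *
      ∑ i, rayInt β (rho β z q dq i) (sideDir z i) w := rfl

theorem dirFactor_ray (β : ℝ) (z : Fin n → ℂ) (i : Fin n) (r : ℝ) :
    dirFactor β (outwardNormal z i) (r * sideDir z i) = r + (β : ℂ) ^ 2 / r := by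
  rw [dirFactor_outwardNormal, ← conj_sideDir, mul_assoc, sideDir_mul_conj, mul_one]

theorem sideExponent_ray (β : ℝ) (z : Fin n → ℂ) (i : Fin n) {r : ℝ} (hr : r ≠ 0) :
    sideExponent β z i (r * sideDir z i) =
      -Complex.I * (spectralVar β (sideLength z i) r : ℝ) := by
  have hu : sideDir z i ≠ 0 := Complex.exp_ne_zero _
  have hr' : (r : ℂ) ≠ 0 := by exact_mod_cast hr
  rw [sideExponent, sub_eq_sideLength_mul, map_mul, Complex.conj_conj, Complex.conj_ofReal,
    conj_sideDir_eq_inv, spectralVar]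
  push_cast
  field_simp
  ring

/-- The spectral function on the line spanned by `e^{-iα_i}`. -/
theorem rho_ray (β : ℝ) (z : Fin n → ℂ) (q dq : Fin n → E01Dual) (i : Fin n) {r : ℝ}
    (hr : r ≠ 0) : rho β z q dq i (r * sideDir z i) = kernel β (r * sideDir z i) (z i) *
      (Complex.I * sideLength z i *
        (dq i (E01.exp (-Complex.I * (spectralVar β (sideLength z i) r : ℝ))) +
        (r + β ^ 2 / r) *
          q i (E01.exp (-Complex.I * (spectralVar β (sideLength z i) r : ℝ))))) := by
  rw [rho, ← dirFactor_outwardNormal, dirFactor_ray, kernelPullback_eq, map_smul, map_smul,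
    sideExponent_ray β z i hr, smul_eq_mul, smul_eq_mul]
  ring

/-! ### Boundary limits of sums of ray integrals -/

theorem sum_rayInt_eq_zero {β : ℝ} (hβ : β ≠ 0) {z : Fin n → ℂ} {F : Fin n → ℂ → ℂ}
    (hF : ∀ j, IsSpectral β (z j) (z (j + 1)) (F j)) (hsum : ∀ l, l ≠ 0 → ∑ j, F j l = 0) {σ w : ℂ}
    (hw : ∀ j, w ∈ decayDomain (z j) (z (j + 1)) σ) : ∑ j, rayInt β (F j) σ w = 0 := by
  unfold rayInt
  rw [← integral_finsetSum _ fun j _ => (hF j).integrableOn_rayFun hβ (hw j)]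
  refine setIntegral_eq_zero_of_forall_eq_zero fun r hr => ?_
  have hl : (r * σ : ℂ) ≠ 0 := mul_ne_zero (by exact_mod_cast (ne_of_gt hr))
    (ne_zero_of_mem_decayDomain (hw 0))
  simp only [rayFun, rayKernel]
  rw [← Finset.sum_mul, ← Finset.sum_div, ← Finset.mul_sum, hsum _ hl]
  simp

/-- Only the coefficient of `r + β²/r` matters; `V` is arbitrary. This freedom lets one statement
serve the Dirichlet and Robin limits. -/
theorem IsConvexPolygon.hasBoundaryLimit {β : ℝ} (hβ : β ≠ 0) {z : Fin n → ℂ}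
    (hz : IsConvexPolygon z) (i : Fin n) {F : Fin n → ℂ → ℂ}
    (hF : ∀ j, IsSpectral β (z j) (z (j + 1)) (F j)) (hsum : ∀ l, l ≠ 0 → ∑ j, F j l = 0)
    {u : E01Dual} {V : ℝ → ℂ}
    (hrep : ∀ r : ℝ, r ≠ 0 → F i (r * sideDir z i) = kernel β (r * sideDir z i) (z i) *
      (Complex.I * sideLength z i * (V (spectralVar β (sideLength z i) r) + (r + β ^ 2 / r) *
        u (E01.exp (-Complex.I * (spectralVar β (sideLength z i) r : ℝ))))))
    {f : ℂ → ℂ} (hf : ∀ w ∈ interiorDomain z, f w = 1 / (4 * Real.pi * Complex.I) *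
      ∑ j, rayInt β (F j) (sideDir z j) w) : HasBoundaryLimit z i f u := by
  obtain ⟨xa, xb, ha, hb, hab⟩ := hz.exists_innerEdge_abscissae i
  refine ⟨fun ε => sidePoint z i (xa ε) ε, fun ε => sidePoint z i (xb ε) ε,
    hab.mono fun ε h => h.2.2.2.2.1, fun φ => ?_⟩
  have hab' : ∀ᶠ ε in 𝓝[>] (0 : ℝ), 0 < ε ∧ 0 ≤ xa ε ∧ xa ε < xb ε ∧ xb ε ≤ 1 ∧
      ∀ x ∈ Icc (xa ε) (xb ε), ∀ j, ε ≤ signedDist z j (sidePoint z i x ε) :=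
    hab.mono fun ε h => ⟨h.1, h.2.1, h.2.2.1, h.2.2.2.1, h.2.2.2.2.2⟩
  have hlim : ∀ j, Tendsto (fun ε => ∫ τ in Ioo (0 : ℝ) 1,
      rayJump β z i j (F j) ((1 - τ) * xa ε + τ * xb ε) ε * φ τ) (𝓝[>] 0)
      (𝓝 (if j = i then 4 * Real.pi * Complex.I * u φ.toE01 else 0)) := by
    intro j
    by_cases hj : j = i
    · subst hj
      rw [if_pos rfl]
      refine (u.tendsto_integral_exp φ (β := β) (hz.sideLength_pos j) ha hb).congr' ?_
      filter_upwards [hab] with ε h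
      refine integral_congr_ae (Eventually.of_forall fun τ => ?_)
      simp only
      rw [hz.rayJump_diagonal hβ j (hF j)
        (U := fun y => u (E01.exp (-Complex.I * y))) (V := V) hrep _ h.1]
    · rw [if_neg hj]
      exact hz.tendsto_rayJump_offDiagonal hβ hj (hF j) ha hb hab' φ
  have hsumlim := (tendsto_finsetSum Finset.univ fun j _ => hlim j).const_mul
    (1 / (4 * Real.pi * Complex.I))
  rw [Finset.sum_ite_eq' Finset.univ i, if_pos (Finset.mem_univ i)] at hsumlim
  have hpi : (Real.pi : ℂ) ≠ 0 := by exact_mod_cast Real.pi_ne_zero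
  rw [show 1 / (4 * Real.pi * Complex.I) * (4 * Real.pi * Complex.I * u φ.toE01) = u φ.toE01 by
    rw [← mul_assoc, one_div_mul_cancel (by simp [hpi]), one_mul]] at hsumlim
  refine hsumlim.congr' ?_
  filter_upwards [hab'] with ε ⟨h0, h1, h2, h3, h4⟩
  rw [integral_zero_one_eq, ← integral_finsetSum, ← integral_const_mul]
  · refine setIntegral_congr_fun measurableSet_Ioo fun τ hτ => ?_
    rw [affineParam_sidePoint]
    set x := (1 - τ) * xa ε + τ * xb ε
    have hx : x ∈ Icc (xa ε) (xb ε) := ⟨by nlinarith [hτ.1, hτ.2], by nlinarith [hτ.1, hτ.2]⟩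
    rw [hf _ (by rw [hz.interiorDomain_eq]; exact fun j => h0.trans_le (h4 x hx j)),
      ← Finset.sum_mul]
    simp only [rayJump]
    -- The subtracted integrals at the mirror image add up to zero by the global relation.
    rw [Finset.sum_sub_distrib, sum_rayInt_eq_zero hβ hF hsum fun j =>
      hz.mem_decayDomain_neg_sideDir i j (by rw [signedDist_sidePoint_self]; linarith), sub_zero]
    ring
  · exact fun j _ => φ.integrableOn_mul (hz.continuousOn_rayJump hβ i j (hF j) h0 h2.le
      fun x hx => h0.trans_le (h4 x hx j))

theorem IsConvexPolygon.mem_decayDomain_of_mem_interiorDomain {z : Fin n → ℂ}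
    (hz : IsConvexPolygon z) {w : ℂ} (hw : w ∈ interiorDomain z) (i : Fin n) :
    w ∈ decayDomain (z i) (z (i + 1)) (sideDir z i) := by
  rw [hz.interiorDomain_eq] at hw
  exact mem_decayDomain_sideDir (hw i)

/-! ### Derivatives of `repQ` and Robin boundary values -/

theorem contDiffAt_finset_sum {ι : Type*} (s : Finset ι) {f : ι → ℂ → ℂ} {w : ℂ}
    (hf : ∀ j ∈ s, ContDiffAt ℝ 2 (f j) w) : ContDiffAt ℝ 2 (∑ j ∈ s, f j) w := by
  rw [Finset.sum_fn]
  exact ContDiffAt.sum hf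

theorem laplacian_finset_sum {ι : Type*} (s : Finset ι) {f : ι → ℂ → ℂ} {w : ℂ}
    (hf : ∀ j ∈ s, ContDiffAt ℝ 2 (f j) w) :
    Laplacian.laplacian (∑ j ∈ s, f j) w = ∑ j ∈ s, Laplacian.laplacian (f j) w := by
  classical
  induction s using Finset.induction_on with
  | empty =>
    rw [Finset.sum_empty, Finset.sum_empty]
    exact congrFun (InnerProductSpace.laplacian_const (c := (0 : ℂ))) w
  | insert a s ha ih =>
    rw [Finset.sum_insert ha, Finset.sum_insert ha,
      ContDiffAt.laplacian_add (hf a (Finset.mem_insert_self a s))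
        (contDiffAt_finset_sum s fun j hj => hf j (Finset.mem_insert_of_mem hj)),
      ih fun j hj => hf j (Finset.mem_insert_of_mem hj)]

theorem IsConvexPolygon.fderiv_repQ_apply {β : ℝ} (hβ : β ≠ 0) {z : Fin n → ℂ}
    (hz : IsConvexPolygon z) (q dq : Fin n → E01Dual) {w : ℂ} (hw : w ∈ interiorDomain z) (v : ℂ) :
    fderiv ℝ (repQ β z q dq) w v = 1 / (4 * Real.pi * Complex.I) *
      ∑ j, rayInt β (fun l => dirFactor β v l * rho β z q dq j l) (sideDir z j) w := by
  have hd := hz.mem_decayDomain_of_mem_interiorDomain hw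
  have h1 : ∀ j, DifferentiableAt ℝ (rayInt β (rho β z q dq j) (sideDir z j)) w := fun j =>
    ((isSpectral_rho β z q dq j).hasFDerivAt_rayInt hβ (hd j)).differentiableAt
  have h2 := (HasFDerivAt.fun_sum (u := Finset.univ) fun j _ => (h1 j).hasFDerivAt).const_mul
    (1 / (4 * Real.pi * Complex.I))
  rw [repQ_eq, h2.fderiv]
  simp only [smul_apply, sum_apply, smul_eq_mul]
  congr 1
  exact Finset.sum_congr rfl fun j _ => (isSpectral_rho β z q dq j).fderiv_rayInt hβ (hd j) v

theorem IsSpectral.rayInt_add_const_mul {β : ℝ} (hβ : β ≠ 0) {a b : ℂ} {F G : ℂ → ℂ}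
    (hF : IsSpectral β a b F) (hG : IsSpectral β a b G) (γ : ℂ) {σ w : ℂ}
    (hw : w ∈ decayDomain a b σ) :
    rayInt β (fun l => F l + γ * G l) σ w = rayInt β F σ w + γ * rayInt β G σ w := by
  unfold rayInt
  rw [← integral_const_mul, ← integral_add (hF.integrableOn_rayFun hβ hw)
    ((hG.integrableOn_rayFun hβ hw).const_mul γ)]
  refine integral_congr_ae (Eventually.of_forall fun r => ?_)
  simp only [rayFun, rayKernel]
  ring

theorem IsConvexPolygon.hasBoundaryLimit_robin {β : ℝ} (hβ : β ≠ 0) {z : Fin n → ℂ}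
    (hz : IsConvexPolygon z) (q dq : Fin n → E01Dual) (hglobal : GlobalRelation β z q dq)
    (i : Fin n) (γ : ℂ) :
    HasBoundaryLimit z i
      (fun w => fderiv ℝ (repQ β z q dq) w (outwardNormal z i) + γ * repQ β z q dq w)
      (dq i + γ • q i) := by
  have hρ := isSpectral_rho β z q dq
  have hN := fun j => (hρ j).dirFactor_mul (outwardNormal z i)
  refine hz.hasBoundaryLimit hβ i (F := fun j l =>
    dirFactor β (outwardNormal z i) l * rho β z q dq j l + γ * rho β z q dq j l)
    -- With `ν = r + β²/r`, the product `(ν + γ)(dq + νq)` equals `(ν²q + γ dq) + ν(dq + γq)`, and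
    -- `ν²` depends on `y` alone.
    (V := fun y => (spectralHeight β (sideLength z i) y : ℂ) ^ 2 * q i (E01.exp (-Complex.I * y)) +
      γ * dq i (E01.exp (-Complex.I * y)))
    (fun j => (hN j).add ((hρ j).const_mul γ)) (fun l hl => ?_) (fun r hr => ?_) fun w hw => ?_
  · rw [Finset.sum_add_distrib, ← Finset.mul_sum, ← Finset.mul_sum, hglobal l hl]
    simp
  · have hr' : (r : ℂ) ≠ 0 := by exact_mod_cast hr
    have hη : (spectralHeight β (sideLength z i) (spectralVar β (sideLength z i) r) : ℂ) ^ 2 =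
        (r + β ^ 2 / r) ^ 2 := by
      have : spectralHeight β (sideLength z i) (spectralVar β (sideLength z i) r) ^ 2 =
          (r + β ^ 2 / r) ^ 2 := by
        rw [spectralHeight, Real.sq_sqrt (by positivity), spectralVar,
          mul_div_cancel_left₀ _ (hz.sideLength_pos i).ne']
        field_simp
        ring
      exact_mod_cast this
    rw [dirFactor_ray, rho_ray β z q dq i hr, hη]
    simp only [add_apply, smul_apply, smul_eq_mul]
    ring
  · rw [hz.fderiv_repQ_apply hβ q dq hw, repQ_eq, mul_left_comm, ← mul_add, Finset.mul_sum,
      ← Finset.sum_add_distrib]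
    congr 1
    exact Finset.sum_congr rfl fun j _ => ((hN j).rayInt_add_const_mul hβ (hρ j) γ
      (hz.mem_decayDomain_of_mem_interiorDomain hw j)).symm

end FokasPolygon

end

/-! ### The Dirichlet, Neumann and Robin problems -/

theorem theorem3p3 {n : ℕ} [NeZero n] (β : ℝ) (hβ : β ≠ 0) (z : Fin n → ℂ)
    (hz : FokasPolygon.IsConvexPolygon z) (q dq : Fin n → FokasPolygon.E01Dual)
    (hglobal : FokasPolygon.GlobalRelation β z q dq) :
    -- the integrals that define `Q` converge absolutely in `Ω`
    (∀ w ∈ FokasPolygon.interiorDomain z, ∀ i,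
      MeasureTheory.IntegrableOn (FokasPolygon.rayIntegrand β z q dq i w) (Ioi 0)) ∧
    -- `Q` is smooth and solves the modified Helmholtz equation in `Ω`
    ContDiffOn ℝ ∞ (FokasPolygon.repQ β z q dq) (FokasPolygon.interiorDomain z) ∧
    (∀ w ∈ FokasPolygon.interiorDomain z,
      -(Laplacian.laplacian (FokasPolygon.repQ β z q dq) w) +
        4 * (β : ℂ) ^ 2 * FokasPolygon.repQ β z q dq w = 0) ∧
    -- Dirichlet, Neumann and Robin boundary limits
    (∀ i, FokasPolygon.HasBoundaryLimit z i (FokasPolygon.repQ β z q dq) (q i)) ∧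
    (∀ i, FokasPolygon.HasBoundaryLimit z i
      (fun w => fderiv ℝ (FokasPolygon.repQ β z q dq) w (FokasPolygon.outwardNormal z i))
      (dq i)) ∧
    (∀ (i : Fin n) (γ : ℂ), FokasPolygon.HasBoundaryLimit z i
      (fun w => fderiv ℝ (FokasPolygon.repQ β z q dq) w (FokasPolygon.outwardNormal z i) +
        γ * FokasPolygon.repQ β z q dq w)
      (dq i + γ • q i)) := by
  have hρ := FokasPolygon.isSpectral_rho β z q dq
  have hd := fun w (hw : w ∈ FokasPolygon.interiorDomain z) =>
    hz.mem_decayDomain_of_mem_interiorDomain hw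
  have hopen : IsOpen (FokasPolygon.interiorDomain z) := isOpen_interior
  have hsmooth : ∀ j, ContDiffOn ℝ ∞
      (FokasPolygon.rayInt β (FokasPolygon.rho β z q dq j) (FokasPolygon.sideDir z j))
      (FokasPolygon.interiorDomain z) := fun j =>
    ((hρ j).contDiffOn_rayInt hβ _).mono fun w hw => hd w hw j
  refine ⟨fun w hw i => (hρ i).integrableOn_rayFun hβ (hd w hw i), ?_, fun w hw => ?_, fun i => ?_,
    fun i => ?_, hz.hasBoundaryLimit_robin hβ q dq hglobal⟩
  · rw [FokasPolygon.repQ_eq]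
    exact contDiffOn_const.mul (ContDiffOn.sum fun j _ => hsmooth j)
  · have h2 : ∀ j, ContDiffAt ℝ 2
        (FokasPolygon.rayInt β (FokasPolygon.rho β z q dq j) (FokasPolygon.sideDir z j)) w :=
      fun j => (contDiffOn_infty.1 (hsmooth j) 2).contDiffAt (hopen.mem_nhds hw)
    have hQ : FokasPolygon.repQ β z q dq = (1 / (4 * Real.pi * Complex.I) : ℂ) •
        ∑ j, FokasPolygon.rayInt β (FokasPolygon.rho β z q dq j) (FokasPolygon.sideDir z j) := by
      ext w
      simp [FokasPolygon.repQ_eq]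
    rw [hQ, InnerProductSpace.laplacian_smul _
      (FokasPolygon.contDiffAt_finset_sum _ fun j _ => h2 j),
      FokasPolygon.laplacian_finset_sum _ fun j _ => h2 j,
      Finset.sum_congr rfl fun j _ => (hρ j).laplacian_rayInt hβ (hd w hw j), ← Finset.mul_sum]
    simp only [Pi.smul_apply, Finset.sum_apply, smul_eq_mul]
    ring
  · exact hz.hasBoundaryLimit hβ i hρ hglobal (fun r hr => FokasPolygon.rho_ray β z q dq i hr)
      (V := fun y => dq i (FokasPolygon.E01.exp (-Complex.I * y))) fun w _ => rfl
  -- The Neumann limit is the Robin limit with `γ = 0`.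
  · have h := hz.hasBoundaryLimit_robin hβ q dq hglobal i 0
    rw [show dq i + (0 : ℂ) • q i = dq i from
      ContinuousLinearMap.ext fun φ => by
        rw [add_apply, smul_apply, zero_smul, add_zero]] at h
    simpa using h
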